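/- **Setting.** Let $T,n,d,b\ge 1$ and $s\ge 0$ be integers. There are $T$ clusters of $n$ datapoints; the datapoints $X^{t,j}$ ($t\in[T]$, $j\in[n]$) take values in $[d]$ with $X^{t,j}\sim \mathrm{Cat}(\mathbf p^t)$, where $\mathbf p^t$ is a probability vector in $\mathbb R^d$ that differs from a central probability vector $\mathbf p^\star$ in at most $s$ entries. The hash functions $h^{t,j}:[d]\to[2^b]$ are uniformly random, and all $X^{t,j}$, $h^{t,j}$ are jointly independent. The server receives the $b$-bit messages $Y^{t,j}=h^{t,j}(X^{t,j})$ and knows the hash functions. Median-based SHIFT with threshold $\alpha$ computes $\check b^t_k=\frac1n|\{j: h^{t,j}(k)=Y^{t,j}\}|$, $\check b^\star_k=\mathrm{median}\{\check b^t_k: t\in[T]\}$, sets $\hat b^t_k=\check b^\star_k$ if $|\check b^\star_k-\check b^t_k|\le\sqrt{\alpha\check b^t_k/n}$ and $\hat b^t_k=\check b^t_k$ otherwise, and outputs $\hat p^t_k=\min\{1,\max\{0,(2^b\hat b^t_k-1)/(2^b-1)\}\}$. Write $b^t_k=((2^b-1)p^t_k+1)/2^b$, $b^\star_k=((2^b-1)p^\star_k+1)/2^b$,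 $\mathcal B_k=\{t: p^t_k\ne p^\star_k\}$, $\mathcal I_\eta=\{k:|\mathcal B_k|<\eta T\}$, $\mathcal I^t=\{k:p^t_k=p^\star_k\}$, and $E(q)=\frac{d}{(2^bTn)^{q/2}}+\frac{d}{n^q}$. **Theorem.** (a) There are absolute constants $c>0$ and $m\in\mathbb N$ such that for all $\kappa,A>0$ there is a constant $C=C(\kappa,A)$ with the following property: if $n\ge 2$, $n\ge\kappa\, 2^b\ln n$ and $c\ln n\le\alpha\le A\ln n$, then for every $t\in[T]$ $$\mathbb E\|\hat{\mathbf p}^t-\mathbf p^t\|_2^2\le C(\ln n)^m\Big(\frac{\max\{2^b,s\}}{2^bn}+\frac{d}{2^bTn}+\frac{d}{n^2}\Big).$$ (b) There is an absolute constant $m\in\mathbb N$ such that for every $A>0$ there is a constant $C=C(A)$ with the following property: if $2^b\le d$, $n\ge 2^{b+6}\ln n$ and $2(8+\sqrt{8\ln n})^2\le\alpha\le A\ln n$, then for every $q\in\{1,2\}$ and $t\in[T]$, for every $0<\eta\le\frac15$, $$\mathbb E\|\hat{\mathbf p}^t-\mathbf p^t\|_q^q\le C(\ln n)^m\Big(\sum_{k\notin\mathcal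 I_\eta\cap\mathcal I^t}\Big(\frac{b^t_k}{n}\Big)^{q/2}+\sum_{k\in\mathcal I_\eta\cap\mathcal I^t}\Big(\frac{|\mathcal B_k|^2b^\star_k}{T^2n}\Big)^{q/2}+E(q)\Big),$$ and $$\mathbb E\|\hat{\mathbf p}^t-\mathbf p^t\|_q^q\le C(\ln n)^m\Big(s^{1-q/2}\Big(\frac{\max\{2^b,s\}}{2^bn}\Big)^{q/2}+E(q)\Big)$$ (with $0^0=1$). For $q=1$ the last bound is $C(\ln n)^m\big(\sqrt{s\max\{2^b,s\}/(2^bn)}+E(1)\big)$. -/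

import Mathlib

open MeasureTheory ProbabilityTheory

noncomputable section

namespace Shift

/-- The median of the `T` real numbers `x 0, …, x (T-1)`: with `y` the nondecreasing rearrangement
of `x` (indexed from `0`) it is `(y ⌊(T-1)/2⌋ + y ⌊T/2⌋) / 2`, that is, the middle value when `T`
is odd and the average of the two middle values when `T` is even. -/
def median {T : ℕ} (x : Fin T → ℝ) : ℝ :=
  if hT : 0 < T then
    (x (Tuple.sort x ⟨(T - 1) / 2, by omega⟩) + x (Tuple.sort x ⟨T / 2, by omega⟩)) / 2
  else 0

/-- Decoding in one cluster: from the messages `y j` and the (shared) hash functions `h j`,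
`j < n`, the hashed estimate of entry `k` is the fraction of those `j` with `h j k = y j`. -/
def hashedEstimate {n d b : ℕ} (h : Fin n → Fin d → Fin (2 ^ b)) (y : Fin n → Fin (2 ^ b))
    (k : Fin d) : ℝ :=
  (((Finset.univ : Finset (Fin n)).filter fun j => h j k = y j).card : ℝ) / (n : ℝ)

/-- Stage I: entry-wise median of the hashed estimates of all clusters. -/
def centralEstimate {T d : ℕ} (B : Fin T → Fin d → ℝ) (k : Fin d) : ℝ :=
  median fun t => B t k

/-- Stage II: the central estimate is kept where it is close to the one of cluster `t`, and
replaced by the latter elsewhere. -/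
def fineTune {T d : ℕ} (n : ℕ) (α : ℝ) (B : Fin T → Fin d → ℝ) (t : Fin T) (k : Fin d) : ℝ :=
  if |centralEstimate B k - B t k| ≤ Real.sqrt (α * B t k / (n : ℝ)) then centralEstimate B k
  else B t k

/-- Debiasing, followed by truncation to `[0, 1]`. -/
def debias (b : ℕ) (x : ℝ) : ℝ :=
  max 0 (min 1 ((2 ^ b * x - 1) / (2 ^ b - 1)))

/-- The median-based SHIFT estimator with threshold parameter `α`, as a function of the hash
functions `h t j` and of the messages `y t j` of all clusters: entry `k` of the estimate of
the distribution of cluster `t`. -/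
def estimator {T n d b : ℕ} (α : ℝ) (h : Fin T → Fin n → Fin d → Fin (2 ^ b))
    (y : Fin T → Fin n → Fin (2 ^ b)) (t : Fin T) (k : Fin d) : ℝ :=
  debias b (fineTune n α (fun t' => hashedEstimate (h t') (y t')) t k)

/-- The data model. There are `T` clusters with `n` datapoints each. The `d`-dimensional
distribution `p t` of cluster `t` differs from the central distribution `pstar` in at most `s`
entries. The datapoint `X t j` has distribution `p t`, the hash function `h t j` is uniformly
distributed over all maps from `Fin d` to `Fin (2 ^ b)`, and all the datapoints and hash functions
are jointly independent. -/
structure Model {Ω : Type*} [MeasurableSpace Ω] (μ : Measure Ω) {T n d b : ℕ} (s : ℕ)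
    (pstar : Fin d → ℝ) (p : Fin T → Fin d → ℝ) (X : Fin T → Fin n → Ω → Fin d)
    (h : Fin T → Fin n → Ω → Fin d → Fin (2 ^ b)) : Prop where
  pstar_mem : pstar ∈ stdSimplex ℝ (Fin d)
  p_mem : ∀ t, p t ∈ stdSimplex ℝ (Fin d)
  sparse : ∀ t, ((Finset.univ : Finset (Fin d)).filter fun k => p t k ≠ pstar k).card ≤ s
  measurable_X : ∀ t j, Measurable (X t j)
  measurable_h : ∀ t j, Measurable (h t j)
  law_X : ∀ t j k, μ.real {ω | X t j ω = k} = p t k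
  law_h : ∀ t j (g : Fin d → Fin (2 ^ b)), μ.real {ω | h t j ω = g} = 1 / ((2 : ℝ) ^ b) ^ d
  indep_pair : ∀ t j, IndepFun (X t j) (h t j) μ
  indep : iIndepFun (fun (i : Fin T × Fin n) ω => (X i.1 i.2 ω, h i.1 i.2 ω)) μ

/-- `E ‖p̂ᵗ - pᵗ‖_q ^ q` for the median-based SHIFT estimator `p̂ᵗ`, computed from the messages
`h t j (X t j)`. -/
def risk {Ω : Type*} [MeasurableSpace Ω] (μ : Measure Ω) {T n d b : ℕ} (q : ℕ) (α : ℝ)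
    (p : Fin T → Fin d → ℝ) (X : Fin T → Fin n → Ω → Fin d)
    (h : Fin T → Fin n → Ω → Fin d → Fin (2 ^ b)) (t : Fin T) : ℝ :=
  ∫ ω, ∑ k, |estimator α (fun t' j => h t' j ω) (fun t' j => h t' j ω (X t' j ω)) t k
    - p t k| ^ q ∂μ

/-- Entry `k` of the mean `((2 ^ b - 1) v + 1) / 2 ^ b` of the hashed estimate for the
distribution `v`. -/
def hashedMean {d : ℕ} (b : ℕ) (v : Fin d → ℝ) (k : Fin d) : ℝ :=
  ((2 ^ b - 1) * v k + 1) / 2 ^ b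

/-- The clusters whose distribution differs from the central one at entry `k`. -/
def misaligned {T d : ℕ} (pstar : Fin d → ℝ) (p : Fin T → Fin d → ℝ) (k : Fin d) :
    Finset (Fin T) :=
  (Finset.univ : Finset (Fin T)).filter fun t => p t k ≠ pstar k

/-- The `η`-well-aligned entries at which, moreover, cluster `t` agrees with the central
distribution. -/
def aligned {T d : ℕ} (η : ℝ) (pstar : Fin d → ℝ) (p : Fin T → Fin d → ℝ) (t : Fin T) :
    Finset (Fin d) :=
  (Finset.univ : Finset (Fin d)).filter fun k =>
    ((misaligned pstar p k).card : ℝ) < η * T ∧ p t k = pstar k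

/-- `E(q; n, d, b, T) = d / (2 ^ b T n) ^ (q / 2) + d / n ^ q`. -/
def remainder (q n d b T : ℕ) : ℝ :=
  (d : ℝ) / ((2 : ℝ) ^ b * T * n) ^ ((q : ℝ) / 2) + (d : ℝ) / (n : ℝ) ^ q

end Shift

end

/-! Fix an entry `k`. A message agrees with the hash of `k` with probability `hashedMean b (p t) k`,
so the counts behind the hashed estimates are independent binomial variables, one per cluster
(`Model.binomialCounts`). Debiasing has slope at most 2 and clipping to `[0, 1]` is a contraction
towards a probability. It therefore suffices to bound the mean square error of Stage II for binomial
counts with parameters `β t`, entry by entry, and to sum.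

Two bounds are available for an entry. The fine-tuned value never leaves the threshold interval
around the local estimate, so the error is always of order `α β t / n` (`integral_sq_le_local`). If
cluster `t` has the central mean `b` and `m` clusters deviate from it, the error is of order `α² (m²
b / (T² n) + b / (T n) + 1 / n²)` (`integral_sq_le_aligned`). For the latter, the `m` deviating
clusters and the fluctuation over clusters shift the majority vote by about `δ = 2m/T + √(32 log n /
T)`. The median thus lies between two quantiles that are `δ` away from level 1/2, and these must be
within `O(δ √(n b)) + 1` of `n b`.

This quantile estimate is the analytic core, and it is not asymptotic: a normal approximation error
would not vanish with `δ`. As a function of the success probability, the distribution function at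
`k` is concave on `[0, k/n]`. It is at least 1/2 at `k/n` (`half_le_binCdf`) and at least 3/4 a few
standard deviations to the left, by Chebyshev. Concavity interpolates linearly between the two
(`binCdf_ge_linear`). Only rounding to an integer is lost; it costs `1/n` in the estimate and
produces the term `d / n ^ q`.

For the sum, the local bound is used off `aligned` and the median bound on it. Double counting of
the pairs (cluster, deviating entry) gives `∑ |B_k| ≤ s T`, where `B_k` is the set of clusters
deviating at `k`. Hence at most `6 s` entries lie off `aligned (1 / 5)`, and Hölder's inequality
turns both sums into the bound in terms of `s`. The case `q = 1` follows from the mean square by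
Jensen. -/

namespace Shift

/-! ### The distribution function of a binomial variable -/

/-- The probability that a binomial variable with parameters `n` and `p` is equal to `i`. -/
noncomputable def binWeight (n : ℕ) (p : ℝ) (i : ℕ) : ℝ := n.choose i * p ^ i * (1 - p) ^ (n - i)

/-- The probability that a binomial variable with parameters `n` and `p` is at most `k`. -/
noncomputable def binCdf (n k : ℕ) (p : ℝ) : ℝ := ∑ i ∈ Finset.range (k + 1), binWeight n p i

lemma binWeight_eq_eval (n : ℕ) (p : ℝ) (i : ℕ) :
    binWeight n p i = (bernsteinPolynomial ℝ n i).eval p := by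
  simp [binWeight, bernsteinPolynomial]

lemma binWeight_nonneg {n : ℕ} {p : ℝ} (h0 : 0 ≤ p) (h1 : p ≤ 1) (i : ℕ) :
    0 ≤ binWeight n p i := by
  have : 0 ≤ 1 - p := by linarith
  unfold binWeight; positivity

lemma sum_binWeight (n : ℕ) (p : ℝ) : ∑ i ∈ Finset.range (n + 1), binWeight n p i = 1 := by
  have := congrArg (Polynomial.eval p) (bernsteinPolynomial.sum ℝ n)
  simpa [Polynomial.eval_finsetSum, ← binWeight_eq_eval] using this

lemma sum_binWeight_mul_id (n : ℕ) (p : ℝ) :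
    ∑ i ∈ Finset.range (n + 1), binWeight n p i * i = n * p := by
  have := congrArg (Polynomial.eval p) (bernsteinPolynomial.sum_smul ℝ n)
  simp only [Polynomial.eval_finsetSum, nsmul_eq_mul, Polynomial.eval_mul, Polynomial.eval_natCast,
    ← binWeight_eq_eval, Polynomial.eval_X] at this
  rw [← this]
  exact Finset.sum_congr rfl fun i _ => mul_comm _ _

lemma sum_binWeight_mul_sq (n : ℕ) (p : ℝ) :
    ∑ i ∈ Finset.range (n + 1), binWeight n p i * ((i : ℝ) - n * p) ^ 2 = n * p * (1 - p) := by
  have := congrArg (Polynomial.eval p) (bernsteinPolynomial.variance ℝ n)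
  simp only [Polynomial.eval_finsetSum, nsmul_eq_mul, Polynomial.eval_mul, Polynomial.eval_natCast,
    ← binWeight_eq_eval, Polynomial.eval_X, Polynomial.eval_pow, Polynomial.eval_sub,
    Polynomial.eval_one] at this
  rw [← this]
  exact Finset.sum_congr rfl fun i _ => by ring

lemma sum_binWeight_mul_exp (n : ℕ) (p l : ℝ) :
    ∑ i ∈ Finset.range (n + 1), binWeight n p i * Real.exp (l * i)
      = (p * Real.exp l + (1 - p)) ^ n := by
  rw [add_pow]
  refine Finset.sum_congr rfl fun i _ => ?_
  rw [binWeight, mul_pow, ← Real.exp_nat_mul, mul_comm l]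
  ring

lemma binWeight_flip {n i : ℕ} (p : ℝ) (hi : i ≤ n) :
    binWeight n (1 - p) (n - i) = binWeight n p i := by
  rw [binWeight, binWeight, Nat.choose_symm hi, Nat.sub_sub_self hi]
  ring

lemma binCdf_self (n : ℕ) (p : ℝ) : binCdf n n p = 1 := sum_binWeight n p

lemma binCdf_nonneg {n k : ℕ} {p : ℝ} (h0 : 0 ≤ p) (h1 : p ≤ 1) : 0 ≤ binCdf n k p :=
  Finset.sum_nonneg fun _ _ => binWeight_nonneg h0 h1 _

lemma binCdf_zero (n k : ℕ) : binCdf n k 0 = 1 := by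
  unfold binCdf
  rw [Finset.sum_eq_single 0]
  · simp [binWeight]
  · intro i _ hi
    simp [binWeight, hi]
  · simp

lemma binCdf_one {n k : ℕ} (h : k < n) : binCdf n k 1 = 0 := by
  refine Finset.sum_eq_zero fun i hi => ?_
  have : n - i ≠ 0 := by have := Finset.mem_range.1 hi; omega
  simp [binWeight, this]

/-- The derivatives of the Bernstein polynomials telescope. Up to the factor `n`, a single weight of
the binomial law with `n - 1` trials remains, so `binCdf n k` is the upper tail of a Beta law. -/
lemma hasDerivAt_binCdf (n k : ℕ) (p : ℝ) :
    HasDerivAt (binCdf n k) (-(n * binWeight (n - 1) p k)) p := by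
  induction k with
  | zero =>
    have := (bernsteinPolynomial ℝ n 0).hasDerivAt p
    rw [bernsteinPolynomial.derivative_zero] at this
    have e : binCdf n 0 = fun x => (bernsteinPolynomial ℝ n 0).eval x := by
      funext x; simp [binCdf, binWeight_eq_eval]
    rw [e]
    exact this.congr_deriv (by simp [binWeight_eq_eval])
  | succ k ih =>
    have := (bernsteinPolynomial ℝ n (k + 1)).hasDerivAt p
    rw [bernsteinPolynomial.derivative_succ] at this
    have e : binCdf n (k + 1)
        = fun x => binCdf n k x + (bernsteinPolynomial ℝ n (k + 1)).eval x := by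
      funext x; simp [binCdf, ← binWeight_eq_eval, Finset.sum_range_succ _ (k + 1)]
    rw [e]
    exact (ih.add this).congr_deriv (by simp [binWeight_eq_eval]; ring)

lemma differentiable_binCdf (n k : ℕ) : Differentiable ℝ (binCdf n k) := fun p =>
  (hasDerivAt_binCdf n k p).differentiableAt

lemma continuous_binCdf (n k : ℕ) : Continuous (binCdf n k) := (differentiable_binCdf n k).continuous

/-- Chebyshev's inequality. -/
lemma binCdf_ge_of_variance {n k : ℕ} {p : ℝ} (h0 : 0 ≤ p) (h1 : p ≤ 1) (hk : k ≤ n) {D : ℝ}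
    (hD : 0 < D) (hkD : n * p + D ≤ k) (hvar : n * p * (1 - p) ≤ D ^ 2 / 4) :
    3 / 4 ≤ binCdf n k p := by
  have hsplit : binCdf n k p + ∑ i ∈ Finset.Ico (k + 1) (n + 1), binWeight n p i = 1 := by
    rw [← sum_binWeight n p, binCdf, Finset.sum_range_add_sum_Ico _ (by omega)]
  have htail : (∑ i ∈ Finset.Ico (k + 1) (n + 1), binWeight n p i) * D ^ 2 ≤ n * p * (1 - p) := by
    rw [← sum_binWeight_mul_sq, Finset.sum_mul]
    refine (Finset.sum_le_sum fun i hi => ?_).trans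
      (Finset.sum_le_sum_of_subset_of_nonneg (s := Finset.Ico (k + 1) (n + 1)) ?_ ?_)
    · refine mul_le_mul_of_nonneg_left ?_ (binWeight_nonneg h0 h1 i)
      have : (k : ℝ) + 1 ≤ i := by exact_mod_cast (Finset.mem_Ico.1 hi).1
      exact pow_le_pow_left₀ hD.le (by linarith) 2
    · intro i hi
      exact Finset.mem_range.2 (Finset.mem_Ico.1 hi).2
    · intro i _ _
      exact mul_nonneg (binWeight_nonneg h0 h1 i) (sq_nonneg _)
  have hD2 : 0 < D ^ 2 := by positivity
  nlinarith

/-! ### The median of a binomial variable with integer mean -/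

lemma binWeight_pred_pos {m k : ℕ} {u : ℝ} (hk : k ≤ m) (h0 : 0 < u) (h1 : u < 1) :
    0 < binWeight m u k := by
  have := Nat.choose_pos hk
  have : 0 < 1 - u := by linarith
  unfold binWeight; positivity

lemma log_binWeight {m k : ℕ} {u : ℝ} (hk : k ≤ m) (h0 : 0 < u) (h1 : u < 1) :
    Real.log (binWeight m u k)
      = Real.log (m.choose k) + k * Real.log u + ((m : ℝ) - k) * Real.log (1 - u) := by
  have h2 : 0 < 1 - u := by linarith
  have h3 : (0 : ℝ) < m.choose k := by exact_mod_cast Nat.choose_pos hk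
  rw [binWeight, Real.log_mul (by positivity) (by positivity),
    Real.log_mul (by positivity) (by positivity), Real.log_pow, Real.log_pow, Nat.cast_sub hk]

/-- If `L` has a nonpositive derivative on `(0, p]` and vanishes at `p` then it is nonnegative. -/
lemma nonneg_of_deriv_nonpos {p : ℝ} {L L' : ℝ → ℝ}
    (hL : ∀ u, 0 < u → u ≤ p → HasDerivAt L (L' u) u)
    (hL' : ∀ u, 0 < u → u < p → L' u ≤ 0) (hp : L p = 0) {u : ℝ} (h0 : 0 < u) (h1 : u ≤ p) :
    0 ≤ L u := by
  have hanti : AntitoneOn L (Set.Icc u p) := by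
    refine antitoneOn_of_deriv_nonpos (convex_Icc _ _) ?_ ?_ ?_
    · exact fun x hx => (hL x (h0.trans_le hx.1) hx.2).continuousAt.continuousWithinAt
    · intro x hx
      rw [interior_Icc] at hx
      exact (hL x (h0.trans hx.1) hx.2.le).differentiableAt.differentiableWithinAt
    · intro x hx
      rw [interior_Icc] at hx
      rw [(hL x (h0.trans hx.1) hx.2.le).deriv]
      exact hL' x (h0.trans hx.1) hx.2
  rw [← hp]
  exact hanti ⟨le_rfl, h1⟩ ⟨h1, le_rfl⟩ h1

/-- Comparison of the mass below and above `p` under the density `-F'`, through a decreasing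
map `φ` that fixes `p`. -/
lemma half_le_of_reflection {p : ℝ} (hp : 0 < p) {F φ φ' f : ℝ → ℝ}
    (hF : ∀ u, HasDerivAt F (-f u) u) (hφ : ∀ u, 0 ≤ u → u ≤ p → HasDerivAt φ (-φ' u) u)
    (hφp : φ p = p) (h0 : 1 ≤ F (φ 0) + F 0)
    (hle : ∀ u, 0 < u → u < p → f u ≤ f (φ u) * φ' u) : 1 / 2 ≤ F p := by
  have hmono : MonotoneOn (fun u => F (φ u) + F u) (Set.Icc 0 p) := by
    have hd : ∀ u, 0 ≤ u → u ≤ p →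
        HasDerivAt (fun u => F (φ u) + F u) (-f (φ u) * -φ' u + -f u) u := fun u hu hu' =>
      ((hF (φ u)).comp u (hφ u hu hu')).add (hF u)
    refine monotoneOn_of_deriv_nonneg (convex_Icc _ _) ?_ ?_ ?_
    · exact fun x hx => (hd x hx.1 hx.2).continuousAt.continuousWithinAt
    · intro x hx
      rw [interior_Icc] at hx
      exact (hd x hx.1.le hx.2.le).differentiableAt.differentiableWithinAt
    · intro x hx
      rw [interior_Icc] at hx
      rw [(hd x hx.1.le hx.2.le).deriv]
      have := hle x hx.1 hx.2
      linarith
  have := hmono ⟨le_rfl, hp.le⟩ ⟨hp.le, le_rfl⟩ hp.le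
  simp only [hφp] at this
  linarith

/-- For `p ≤ 1/2` the reflection `u ↦ 2p - u` maps `[0, p]` into `[0, 1]`. The Beta density is
larger at the reflected point because the log ratio of the two values decreases to 0 at `p`. -/
lemma half_le_binCdf_of_le_half {m k : ℕ} (hk0 : 0 < k) (hk : 2 * k ≤ m + 1) :
    1 / 2 ≤ binCdf (m + 1) k (k / (m + 1)) := by
  have hkm : k ≤ m := by omega
  have hm : (0 : ℝ) < m + 1 := by positivity
  have hk' : (0 : ℝ) < k := by exact_mod_cast hk0
  have hk2 : 2 * (k : ℝ) ≤ m + 1 := by exact_mod_cast hk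
  set p : ℝ := k / (m + 1) with hp
  have hkp : (k : ℝ) = (m + 1) * p := by rw [hp]; field_simp
  have hp0 : 0 < p := by positivity
  have hp1 : 2 * p ≤ 1 := by
    rw [hp, ← mul_div_assoc, div_le_one hm]; exact hk2
  refine half_le_of_reflection (F := binCdf (m + 1) k) (φ := fun u => 2 * p - u) (φ' := fun _ => 1)
    (f := fun u => ((m + 1 : ℕ) : ℝ) * binWeight m u k) hp0 ?_ ?_ (by ring) ?_ ?_
  · intro u
    simpa using hasDerivAt_binCdf (m + 1) k u
  · intro u _ _
    simpa using (hasDerivAt_id u).const_sub (2 * p)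
  · rw [binCdf_zero]
    have := binCdf_nonneg (n := m + 1) (k := k) (p := 2 * p - 0) (by linarith) (by linarith)
    linarith
  · intro u hu0 hup
    rw [mul_one]
    refine mul_le_mul_of_nonneg_left ?_ (by positivity)
    rw [← Real.log_le_log_iff (binWeight_pred_pos hkm hu0 (by linarith))
      (binWeight_pred_pos hkm (by linarith) (by linarith)), log_binWeight hkm hu0 (by linarith),
      log_binWeight hkm (by linarith) (by linarith), ← sub_nonneg]
    have key := nonneg_of_deriv_nonpos (p := p)
      (L := fun u => k * Real.log (2 * p - u) + ((m : ℝ) - k) * Real.log (1 - (2 * p - u))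
        - k * Real.log u - ((m : ℝ) - k) * Real.log (1 - u))
      (L' := fun u => k * (-1 / (2 * p - u)) + ((m : ℝ) - k) * (1 / (1 - (2 * p - u)))
        - k * (1 / u) - ((m : ℝ) - k) * (-1 / (1 - u))) ?_ ?_ ?_ hu0 hup.le
    · linarith
    · intro v hv0 hvp
      have e1 : HasDerivAt (fun v : ℝ => 2 * p - v) (-1) v := by
        simpa using (hasDerivAt_id v).const_sub (2 * p)
      have e2 : HasDerivAt (fun v : ℝ => 1 - (2 * p - v)) 1 v := by
        simpa using e1.const_sub 1
      have e3 : HasDerivAt (fun v : ℝ => 1 - v) (-1) v := by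
        simpa using (hasDerivAt_id v).const_sub 1
      exact ((((e1.log (by linarith)).const_mul _).add
        ((e2.log (by linarith)).const_mul _)).sub
        (((hasDerivAt_id v).log (by simpa using hv0.ne')).const_mul _)).sub
        ((e3.log (by linarith)).const_mul _)
    · intro v hv0 hvp
      have h1 : 0 < 2 * p - v := by linarith
      have h2 : 0 < 1 - (2 * p - v) := by linarith
      have h3 : 0 < 1 - v := by linarith
      have e : k * (-1 / (2 * p - v)) + ((m : ℝ) - k) * (1 / (1 - (2 * p - v)))
          - k * (1 / v) - ((m : ℝ) - k) * (-1 / (1 - v))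
          = (((m : ℝ) - k) * (2 * (1 - p)) * ((2 * p - v) * v)
              - k * (2 * p) * ((1 - (2 * p - v)) * (1 - v)))
            / (((2 * p - v) * v) * ((1 - (2 * p - v)) * (1 - v))) := by
        field_simp; ring
      rw [e]
      refine div_nonpos_of_nonpos_of_nonneg ?_ (by positivity)
      have hmk : (m : ℝ) - k = (m + 1) * (1 - p) - 1 := by rw [hkp]; ring
      rw [hmk, hkp]
      have a1 : ((m + 1) * (1 - p) - 1) * (2 * (1 - p)) * ((2 * p - v) * v)
          ≤ ((m + 1) * (1 - p)) * (2 * (1 - p)) * ((2 * p - v) * v) := by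
        have : 0 ≤ (2 * (1 - p)) * ((2 * p - v) * v) := by
          have : 0 ≤ 1 - p := by linarith
          positivity
        nlinarith
      -- This is where `p ≤ 1/2` enters: the difference of the two sides is `(1 - 2p)(p - v)²`.
      have a2 : (1 - p) ^ 2 * ((2 * p - v) * v) ≤ p ^ 2 * ((1 - (2 * p - v)) * (1 - v)) := by
        have : p ^ 2 * ((1 - (2 * p - v)) * (1 - v)) - (1 - p) ^ 2 * ((2 * p - v) * v)
          = (1 - 2 * p) * (p - v) ^ 2 := by ring
        have : 0 ≤ (1 - 2 * p) * (p - v) ^ 2 := mul_nonneg (by linarith) (sq_nonneg _)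
        linarith
      have a3 := mul_le_mul_of_nonneg_left a2 (show (0 : ℝ) ≤ 2 * (m + 1) by positivity)
      linarith
    · ring_nf

/-- For `p > 1/2` the point `2p - u` can exceed 1, so the reflection is made in the odds: `φ u` is
defined by requiring that the odds of `u` and of `φ u` multiply to `(p / (1 - p))²`. It exchanges
the endpoints 0 and 1 and fixes `p`; its Jacobian enters the comparison of densities. -/
lemma half_le_binCdf_of_half_le {m k : ℕ} (hkm : k ≤ m) (hk : m + 1 ≤ 2 * k) :
    1 / 2 ≤ binCdf (m + 1) k (k / (m + 1)) := by
  have hm : (0 : ℝ) < m + 1 := by positivity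
  have hk2 : (m : ℝ) + 1 ≤ 2 * (k : ℝ) := by exact_mod_cast hk
  have hk' : (0 : ℝ) < k := by linarith
  have hkm' : (k : ℝ) ≤ m := by exact_mod_cast hkm
  set p : ℝ := k / (m + 1) with hp
  have hkp : (k : ℝ) = (m + 1) * p := by rw [hp]; field_simp
  have hp0 : 0 < p := by positivity
  have hp1 : p < 1 := by rw [hp, div_lt_one hm]; linarith
  have hp2 : 1 ≤ 2 * p := by rw [hp, ← mul_div_assoc, le_div_iff₀ hm]; linarith
  have hq : 0 < 1 - p := by linarith
  have hden : ∀ u, 0 ≤ u → u ≤ p → 0 < p ^ 2 * (1 - u) + (1 - p) ^ 2 * u := by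
    intro u h0 h1
    have : 0 < 1 - u := by linarith
    positivity
  have hφ0 : ∀ u, 0 ≤ u → u ≤ p → 0 < p ^ 2 * (1 - u) / (p ^ 2 * (1 - u) + (1 - p) ^ 2 * u) := by
    intro u h0 h1
    have := hden u h0 h1
    have : 0 < 1 - u := by linarith
    positivity
  have hφ1 : ∀ u, 0 ≤ u → u ≤ p → 1 - p ^ 2 * (1 - u) / (p ^ 2 * (1 - u) + (1 - p) ^ 2 * u)
      = (1 - p) ^ 2 * u / (p ^ 2 * (1 - u) + (1 - p) ^ 2 * u) := by
    intro u h0 h1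
    rw [eq_div_iff (hden u h0 h1).ne', sub_mul, div_mul_cancel₀ _ (hden u h0 h1).ne']
    ring
  refine half_le_of_reflection (F := binCdf (m + 1) k)
    (φ := fun u => p ^ 2 * (1 - u) / (p ^ 2 * (1 - u) + (1 - p) ^ 2 * u))
    (φ' := fun u => p ^ 2 * (1 - p) ^ 2 / (p ^ 2 * (1 - u) + (1 - p) ^ 2 * u) ^ 2)
    (f := fun u => ((m + 1 : ℕ) : ℝ) * binWeight m u k) hp0 ?_ ?_ ?_ ?_ ?_
  · intro u
    simpa using hasDerivAt_binCdf (m + 1) k u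
  · intro u h0 h1
    have e1 : HasDerivAt (fun u : ℝ => p ^ 2 * (1 - u)) (p ^ 2 * -1) u :=
      ((hasDerivAt_id u).const_sub 1).const_mul _
    have e2 : HasDerivAt (fun u : ℝ => (1 - p) ^ 2 * u) ((1 - p) ^ 2 * 1) u :=
      (hasDerivAt_id u).const_mul _
    have := e1.div (e1.add e2) (hden u h0 h1).ne'
    refine this.congr_deriv ?_
    simp only [Pi.add_apply]
    rw [← neg_div]
    congr 1
    ring
  · have := hden p hp0.le le_rfl
    field_simp
    ring
  · have : p ^ 2 * (1 - 0) / (p ^ 2 * (1 - 0) + (1 - p) ^ 2 * 0) = 1 := by field_simp; simp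
    rw [this, binCdf_zero, binCdf_one (by omega)]
    norm_num
  · intro u hu0 hup
    have hd := hden u hu0.le hup.le
    have h1u : 0 < 1 - u := by linarith
    have hφpos := hφ0 u hu0.le hup.le
    have hφlt : p ^ 2 * (1 - u) / (p ^ 2 * (1 - u) + (1 - p) ^ 2 * u) < 1 := by
      rw [div_lt_one hd]
      have : 0 < (1 - p) ^ 2 * u := by positivity
      linarith
    rw [mul_assoc]
    refine mul_le_mul_of_nonneg_left ?_ (by positivity)
    have hw := binWeight_pred_pos hkm hφpos hφlt
    rw [← Real.log_le_log_iff (binWeight_pred_pos hkm hu0 (by linarith)) (by positivity),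
      Real.log_mul hw.ne' (by positivity), log_binWeight hkm hu0 (by linarith),
      log_binWeight hkm hφpos hφlt, hφ1 u hu0.le hup.le, ← sub_nonneg]
    rw [Real.log_div (by positivity) hd.ne', Real.log_div (by positivity) hd.ne',
      Real.log_div (by positivity) (by positivity), Real.log_mul (by positivity) h1u.ne',
      Real.log_mul (by positivity) hu0.ne', Real.log_mul (by positivity) (by positivity),
      Real.log_pow, Real.log_pow, Real.log_pow]
    have key := nonneg_of_deriv_nonpos (p := p)
      (L := fun u => ((m : ℝ) - 2 * k) * (Real.log u - Real.log (1 - u))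
        - ((m : ℝ) + 2) * Real.log (p ^ 2 * (1 - u) + (1 - p) ^ 2 * u)
        + (2 * k + 2) * Real.log p + 2 * ((m : ℝ) - k + 1) * Real.log (1 - p))
      (L' := fun u => ((m : ℝ) - 2 * k) * (1 / u - -1 / (1 - u))
        - ((m : ℝ) + 2) * ((p ^ 2 * -1 + (1 - p) ^ 2 * 1) / (p ^ 2 * (1 - u) + (1 - p) ^ 2 * u)))
      ?_ ?_ ?_ hu0 hup.le
    · push_cast
      linarith
    · intro v hv0 hvp
      have e1 : HasDerivAt (fun u : ℝ => p ^ 2 * (1 - u)) (p ^ 2 * -1) v :=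
        ((hasDerivAt_id v).const_sub 1).const_mul _
      have e2 : HasDerivAt (fun u : ℝ => (1 - p) ^ 2 * u) ((1 - p) ^ 2 * 1) v :=
        (hasDerivAt_id v).const_mul _
      have e3 : HasDerivAt (fun v : ℝ => 1 - v) (-1) v := by
        simpa using (hasDerivAt_id v).const_sub 1
      exact ((((((hasDerivAt_id v).log (by simpa using hv0.ne')).sub
        (e3.log (by linarith))).const_mul _).sub
        (((e1.add e2).log (hden v hv0.le hvp).ne').const_mul _)).add_const _).add_const _
    · intro v hv0 hvp
      have hd := hden v hv0.le hvp.le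
      have h1v : 0 < 1 - v := by linarith
      have e : ((m : ℝ) - 2 * k) * (1 / v - -1 / (1 - v))
          - ((m : ℝ) + 2) * ((p ^ 2 * -1 + (1 - p) ^ 2 * 1) / (p ^ 2 * (1 - v) + (1 - p) ^ 2 * v))
          = (((m : ℝ) + 2) * (2 * p - 1) * (v * (1 - v))
              - (2 * k - m) * (p ^ 2 * (1 - v) + (1 - p) ^ 2 * v))
            / (v * (1 - v) * (p ^ 2 * (1 - v) + (1 - p) ^ 2 * v)) := by
        field_simp; ring
      rw [e]
      refine div_nonpos_of_nonpos_of_nonneg ?_ (by positivity)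
      have hde : p ^ 2 * (1 - v) + (1 - p) ^ 2 * v = v * (1 - v) + (p - v) ^ 2 := by ring
      -- With `k = (m + 1) p` the right side exceeds the left by `2 (1 - p)`.
      have a1 : ((m : ℝ) + 2) * (2 * p - 1) ≤ 2 * k - m := by rw [hkp]; linarith
      have a2 : v * (1 - v) ≤ p ^ 2 * (1 - v) + (1 - p) ^ 2 * v := by
        rw [hde]; linarith [sq_nonneg (p - v)]
      have a3 : 0 ≤ v * (1 - v) := by positivity
      have a4 : 0 ≤ 2 * (k : ℝ) - m := by linarith
      have := mul_le_mul a1 a2 a3 a4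
      linarith
    · have : p ^ 2 * (1 - p) + (1 - p) ^ 2 * p = p * (1 - p) := by ring
      simp only [this]
      rw [Real.log_mul hp0.ne' hq.ne']
      ring

/-- A binomial variable with integer mean `k` is at most `k` with probability at least `1 / 2`. -/
lemma half_le_binCdf {n k : ℕ} (hn : 0 < n) (hk : k ≤ n) : 1 / 2 ≤ binCdf n k (k / n) := by
  obtain ⟨m, rfl⟩ : ∃ m, n = m + 1 := ⟨n - 1, by omega⟩
  push_cast
  rcases Nat.eq_zero_or_pos k with rfl | hk0
  · norm_num [binCdf_zero]
  rcases hk.eq_or_lt with rfl | hlt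
  · norm_num [binCdf_self]
  rcases le_total (2 * k) (m + 1) with h | h
  · exact half_le_binCdf_of_le_half hk0 h
  · exact half_le_binCdf_of_half_le (by omega) h

/-! ### Quantiles of a binomial variable -/

/-- The likelihood `u ^ k (1 - u) ^ (m - k)` increases up to its maximiser `k / m`. -/
lemma binWeight_monotoneOn {m k : ℕ} (hk : k ≤ m) :
    MonotoneOn (fun u => binWeight m u k) (Set.Icc 0 (k / m)) := by
  rcases Nat.eq_zero_or_pos k with rfl | hk0
  · intro x hx y hy _
    have hx' : x = 0 := by have := hx.1; have := hx.2; simp at *; linarith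
    have hy' : y = 0 := by have := hy.1; have := hy.2; simp at *; linarith
    simp [hx', hy']
  have hm : (0 : ℝ) < m := by exact_mod_cast hk0.trans_le hk
  have hd : ∀ u : ℝ, HasDerivAt (fun u => binWeight m u k)
      (m.choose k * (k * u ^ (k - 1)) * (1 - u) ^ (m - k)
        + m.choose k * u ^ k * (((m - k : ℕ) : ℝ) * (1 - u) ^ (m - k - 1) * -1)) u := by
    intro u
    have e3 : HasDerivAt (fun v : ℝ => 1 - v) (-1) u := by
      simpa using (hasDerivAt_id u).const_sub 1
    exact ((hasDerivAt_pow k u).const_mul _).mul (e3.pow (m - k))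
  refine monotoneOn_of_deriv_nonneg (convex_Icc _ _) ?_ ?_ ?_
  · exact fun x _ => (hd x).continuousAt.continuousWithinAt
  · exact fun x _ => (hd x).differentiableAt.differentiableWithinAt
  · intro u hu
    rw [interior_Icc] at hu
    rw [(hd u).deriv]
    have hu0 : 0 < u := hu.1
    have hu1 : u * m ≤ k := ((lt_div_iff₀ hm).1 hu.2).le
    have hu2 : u < 1 := hu.2.trans_le (by rw [div_le_one hm]; exact_mod_cast hk)
    have h1u : 0 < 1 - u := by linarith
    rcases hk.eq_or_lt with rfl | hlt
    · simp only [Nat.sub_self, Nat.cast_zero]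
      simp only [pow_zero, zero_mul, mul_zero, add_zero, mul_one]
      positivity
    · obtain ⟨j, rfl⟩ : ∃ j, k = j + 1 := ⟨k - 1, by omega⟩
      obtain ⟨l, hl⟩ : ∃ l, m - (j + 1) = l + 1 := ⟨m - (j + 1) - 1, by omega⟩
      have hcast : (m : ℝ) = j + 1 + (l + 1) := by
        have : m = j + 1 + (l + 1) := by omega
        exact_mod_cast this
      rw [hl]
      simp only [Nat.add_sub_cancel]
      have : (m.choose (j + 1) : ℝ) * (((j + 1 : ℕ) : ℝ) * u ^ j) * (1 - u) ^ (l + 1)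
          + m.choose (j + 1) * u ^ (j + 1) * (((l + 1 : ℕ) : ℝ) * (1 - u) ^ l * -1)
          = m.choose (j + 1) * u ^ j * (1 - u) ^ l * (j + 1 - u * m) := by
        rw [hcast]; push_cast; ring
      rw [this]
      push_cast at hu1
      have : 0 ≤ (j : ℝ) + 1 - u * m := by linarith
      positivity

/-- The derivative is minus a weight with `n - 1` trials, which increases up to `k / (n - 1) ≥ k /
n`. -/
lemma concaveOn_binCdf {n k : ℕ} (hk : k < n) : ConcaveOn ℝ (Set.Icc 0 (k / n : ℝ)) (binCdf n k) := by
  refine AntitoneOn.concaveOn_of_deriv (convex_Icc _ _) (continuous_binCdf n k).continuousOn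
    (differentiable_binCdf n k).differentiableOn ?_
  rw [interior_Icc]
  have hle : (k / n : ℝ) ≤ k / ((n - 1 : ℕ) : ℝ) := by
    rcases Nat.eq_zero_or_pos k with rfl | hk0
    · simp
    · have : (0 : ℝ) < ((n - 1 : ℕ) : ℝ) := by exact_mod_cast (by omega : 0 < n - 1)
      refine div_le_div_of_nonneg_left (by positivity) this ?_
      exact_mod_cast Nat.sub_le n 1
  intro x hx y hy hxy
  rw [(hasDerivAt_binCdf n k x).deriv, (hasDerivAt_binCdf n k y).deriv, neg_le_neg_iff]
  refine mul_le_mul_of_nonneg_left ?_ (by positivity)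
  exact binWeight_monotoneOn (by omega : k ≤ n - 1) ⟨hx.1.le, hx.2.le.trans hle⟩
    ⟨hy.1.le, hy.2.le.trans hle⟩ hxy

/-- The distribution function grows at least linearly above the mean. -/
lemma binCdf_ge_linear {n k : ℕ} {p D : ℝ} (hn : 0 < n) (hk : k ≤ n) (h0 : 0 ≤ p)
    (hD : 0 < D) (hpk : n * p ≤ k) (hkD : k ≤ n * p + D)
    (hvar : ∀ r : ℝ, 0 ≤ r → n * r + D = k → n * r * (1 - r) ≤ D ^ 2 / 4) :
    1 / 2 + (k - n * p) / (4 * D) ≤ binCdf n k p := by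
  have hn' : (0 : ℝ) < n := by exact_mod_cast hn
  have hgain : (k - n * p) / (4 * D) ≤ 1 / 4 := by
    rw [div_le_iff₀ (by positivity)]; linarith
  rcases hk.eq_or_lt with rfl | hlt
  · rw [binCdf_self]; linarith
  have hkn : (k : ℝ) / n < 1 := by rw [div_lt_one hn']; exact_mod_cast hlt
  have hpk' : p ≤ k / n := by rw [le_div_iff₀ hn']; linarith
  have hhalf := half_le_binCdf hn hk
  -- The left interpolation point has mean `k - D`, where Chebyshev applies; if this is negative, `r
  -- = 0` serves, where the distribution function is 1.
  obtain ⟨r, hr0, hrp, hrD, hr⟩ : ∃ r : ℝ, 0 ≤ r ∧ r ≤ p ∧ k - n * r ≤ D ∧ 3 / 4 ≤ binCdf n k r := by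
    rcases le_total 0 ((k - D) / n) with h | h
    · have e : n * ((k - D) / n) + D = k := by field_simp; ring
      refine ⟨(k - D) / n, h, ?_, by linarith, ?_⟩
      · rw [div_le_iff₀ hn']; linarith
      · refine binCdf_ge_of_variance h ?_ hk hD e.le (hvar _ h e)
        rw [div_le_one hn']
        have : (k : ℝ) ≤ n := by exact_mod_cast hk
        linarith
    · refine ⟨0, le_rfl, h0, ?_, ?_⟩
      · rw [div_le_iff₀ hn'] at h; linarith
      · rw [binCdf_zero]; norm_num
  rcases hpk'.eq_or_lt with heq | hplt
  · have : (k : ℝ) - n * p = 0 := by rw [heq]; field_simp; ring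
    rw [this, zero_div, add_zero, heq]
    exact hhalf
  have hrk : 0 < (k : ℝ) / n - r := by linarith
  have hconc := (concaveOn_binCdf hlt).2 (show r ∈ Set.Icc 0 (k / n : ℝ) from ⟨hr0, by linarith⟩)
    (show (k / n : ℝ) ∈ Set.Icc 0 (k / n : ℝ) from ⟨by positivity, le_rfl⟩)
    (show 0 ≤ ((k : ℝ) / n - p) / (k / n - r) from div_nonneg (by linarith) hrk.le)
    (show 0 ≤ (p - r) / (k / n - r) from div_nonneg (by linarith) hrk.le) (by
      rw [← add_div, sub_add_sub_cancel, div_self hrk.ne'])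
  have hcomb : (((k : ℝ) / n - p) / (k / n - r)) • r + ((p - r) / (k / n - r)) • (k / n : ℝ) = p := by
    simp only [smul_eq_mul]
    generalize (k / n : ℝ) = z at hrk
    field_simp
    ring
  rw [hcomb] at hconc
  simp only [smul_eq_mul] at hconc
  -- The weight of `r` in the convex combination; each unit of it gains `3/4 - 1/2 = 1/4` over the
  -- value at `k / n`.
  have ha : (k - n * p) / D ≤ ((k : ℝ) / n - p) / (k / n - r) := by
    rw [div_le_div_iff₀ hD hrk]
    have e1 : (k : ℝ) - n * p = n * (k / n - p) := by field_simp
    have e2 : n * (k / n - r) ≤ D := by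
      have : n * (k / n - r) = k - n * r := by field_simp
      linarith
    rw [e1]
    have : 0 ≤ (k : ℝ) / n - p := by linarith
    nlinarith
  have hab : ((k : ℝ) / n - p) / (k / n - r) + (p - r) / (k / n - r) = 1 := by
    rw [← add_div, sub_add_sub_cancel, div_self hrk.ne']
  have ha0 : 0 ≤ ((k : ℝ) / n - p) / (k / n - r) := div_nonneg (by linarith) hrk.le
  have hb0 : 0 ≤ (p - r) / (k / n - r) := div_nonneg (by linarith) hrk.le
  have m1 := mul_le_mul_of_nonneg_left hr ha0
  have m2 := mul_le_mul_of_nonneg_left hhalf hb0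
  have e4 : (k - n * p) / (4 * D) = (k - n * p) / D / 4 := by field_simp
  rw [e4]
  linarith

end Shift

namespace Shift

/-- Linear growth with `D = 4 √(np)` gains `δ` over a distance `16 δ √(np)`; the final 1 pays for
rounding up. -/
lemma exists_upper_quantile {n : ℕ} {p δ : ℝ} (hn : 0 < n) (h0 : 0 ≤ p)
    (hμ : 4 ≤ n * p) (hδ0 : 0 ≤ δ) (hδ : δ ≤ 1 / 8) :
    ∃ k : ℕ, k ≤ n ∧ (k : ℝ) ≤ n * p + 16 * δ * √(n * p) + 1 ∧ 1 / 2 + δ ≤ binCdf n k p := by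
  have hs2 : 2 ≤ √(n * p) := Real.le_sqrt_of_sq_le (by linarith)
  have hsq : √(n * p) ^ 2 = n * p := Real.sq_sqrt (by linarith)
  set s := √(n * p)
  have hδs : 0 ≤ δ * s := by positivity
  have hδs' : δ * s ≤ s / 8 := by nlinarith
  by_cases hk : ⌈n * p + 16 * δ * s⌉₊ ≤ n
  · have hle := Nat.le_ceil (n * p + 16 * δ * s)
    have hlt := Nat.ceil_lt_add_one (a := n * p + 16 * δ * s) (by nlinarith)
    refine ⟨_, hk, hlt.le, ?_⟩
    have hD : 0 < 4 * s := by linarith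
    refine le_trans ?_ (binCdf_ge_linear (D := 4 * s) hn hk h0 hD (by linarith) (by linarith) ?_)
    · have : δ ≤ (⌈n * p + 16 * δ * s⌉₊ - n * p) / (4 * (4 * s)) := by
        rw [le_div_iff₀ (by positivity)]
        linarith
      linarith
    · intro r hr hrk
      have : n * r * (1 - r) ≤ n * r := by
        have : 0 ≤ n * r := by positivity
        nlinarith
      nlinarith
  -- When the rounded quantile exceeds `n`, the trivial choice `k = n` is already below the required
  -- bound.
  · refine ⟨n, le_rfl, ?_, ?_⟩
    · have := (Nat.lt_ceil.1 (not_le.1 hk)).le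
      linarith
    · rw [binCdf_self]; linarith

/-- The upper quantile argument for the number of failures. The scale must remain `√(np)`, not
`√(n(1-p))`, which is why `binCdf_ge_linear` assumes a bound on the variance instead of the mean. -/
lemma exists_lower_quantile {n : ℕ} {p δ : ℝ} (hn : 0 < n) (h1 : p ≤ 1)
    (hμ : 4 ≤ n * p) (hδ0 : 0 ≤ δ) (hδ : δ ≤ 1 / 8) :
    ∃ k : ℕ, k ≤ n ∧ n * p - 16 * δ * √(n * p) - 1 ≤ k ∧
      1 / 2 + δ ≤ binCdf n (n - k) (1 - p) := by
  have hs2 : 2 ≤ √(n * p) := Real.le_sqrt_of_sq_le (by linarith)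
  have hsq : √(n * p) ^ 2 = n * p := Real.sq_sqrt (by linarith)
  set s := √(n * p)
  have hδs : 0 ≤ δ * s := by positivity
  have hδs' : δ * s ≤ s / 8 := by nlinarith
  have hn' : (0 : ℝ) < n := by exact_mod_cast hn
  have hnp : n * p ≤ n := by nlinarith
  have hle := Nat.floor_le (a := n * p - 16 * δ * s) (by nlinarith)
  have hlt := Nat.sub_one_lt_floor (n * p - 16 * δ * s)
  have hkn : ⌊n * p - 16 * δ * s⌋₊ ≤ n := Nat.floor_le_of_le (by linarith)
  refine ⟨_, hkn, hlt.le, ?_⟩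
  have hcast : ((n - ⌊n * p - 16 * δ * s⌋₊ : ℕ) : ℝ) = n - ⌊n * p - 16 * δ * s⌋₊ :=
    Nat.cast_sub hkn
  have hD : 0 < 4 * s := by linarith
  refine le_trans ?_ (binCdf_ge_linear (D := 4 * s) hn (Nat.sub_le _ _) (by linarith) hD ?_ ?_ ?_)
  · rw [hcast]
    have : δ ≤ (n - ⌊n * p - 16 * δ * s⌋₊ - n * (1 - p)) / (4 * (4 * s)) := by
      rw [le_div_iff₀ (by positivity)]
      linarith
    linarith
  · rw [hcast]; linarith
  · rw [hcast]; linarith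
  · intro r hr hrk
    rw [hcast] at hrk
    have hr1 : r ≤ 1 := by
      have : (0 : ℝ) ≤ ⌊n * p - 16 * δ * s⌋₊ := by positivity
      nlinarith
    have e : n * r * (1 - r) ≤ n * (1 - r) := by
      have : 0 ≤ n * (1 - r) := mul_nonneg hn'.le (by linarith)
      nlinarith
    nlinarith

/-! ### The median -/

lemma card_filter_comp_perm {T : ℕ} (P : Fin T → Prop) [DecidablePred P] (e : Equiv.Perm (Fin T)) :
    (Finset.univ.filter fun i => P (e i)).card = (Finset.univ.filter P).card :=
  Finset.card_bij (fun i _ => e i) (by simp) (by simp) fun j hj => ⟨e.symm j, by simpa using hj, by simp⟩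

-- Both middle positions are at most `⌊T/2⌋`, hence smaller than a count exceeding `T/2`.
open Classical in
lemma median_le {T : ℕ} {x : Fin T → ℝ} {v : ℝ}
    (h : T < 2 * (Finset.univ.filter fun t => x t ≤ v).card) : median x ≤ v := by
  have hT : 0 < T := by
    have : (Finset.univ.filter fun t => x t ≤ v).card ≤ T := by
      simpa using Finset.card_le_univ (Finset.univ.filter fun t => x t ≤ v)
    omega
  have hc := card_filter_comp_perm (fun t => x t ≤ v) (Tuple.sort x)
  have key : ∀ j : Fin T, (j : ℕ) ≤ T / 2 → x (Tuple.sort x j) ≤ v := by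
    intro j hj
    refine (Tuple.lt_card_le_iff_apply_le_of_monotone (f := x ∘ Tuple.sort x) (a := v)
      (Tuple.monotone_sort x)).1 ?_
    simp only [Function.comp_apply]
    have : (Finset.univ.filter fun i => x (Tuple.sort x i) ≤ v).card
      = (Finset.univ.filter fun t => x t ≤ v).card := hc
    convert (show (j : ℕ) < _ by rw [← this] at h; exact (by omega :
      (j : ℕ) < (Finset.univ.filter fun i => x (Tuple.sort x i) ≤ v).card))
  rw [median, dif_pos hT]
  have h1 := key ⟨(T - 1) / 2, by omega⟩ (by simp only; omega)
  have h2 := key ⟨T / 2, by omega⟩ le_rfl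
  linarith

open Classical in
lemma le_median {T : ℕ} {x : Fin T → ℝ} {v : ℝ}
    (h : T < 2 * (Finset.univ.filter fun t => v ≤ x t).card) : v ≤ median x := by
  have hle : (Finset.univ.filter fun t => v ≤ x t).card ≤ T := by
    simpa using Finset.card_le_univ (Finset.univ.filter fun t => v ≤ x t)
  have hT : 0 < T := by omega
  have hc := card_filter_comp_perm (fun t => x t < v) (Tuple.sort x)
  have hsum : (Finset.univ.filter fun t => v ≤ x t).card
      + (Finset.univ.filter fun t => x t < v).card = T := by
    have := Finset.card_filter_add_card_filter_not (s := (Finset.univ : Finset (Fin T)))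
      (p := fun t => v ≤ x t)
    simpa [not_le] using this
  -- The lower middle index `⌊(T-1)/2⌋` just satisfies `T ≤ 2j + 2`; fewer than `T/2` values lie
  -- below `v`, so they end before it.
  have key : ∀ j : Fin T, T ≤ 2 * (j : ℕ) + 2 → v ≤ x (Tuple.sort x j) := by
    intro j hj
    by_contra hlt
    have := (Tuple.lt_card_lt_iff_apply_lt_of_monotone (f := x ∘ Tuple.sort x) (a := v)
      (j := j) (Tuple.monotone_sort x)).2 (not_le.1 hlt)
    simp only [Function.comp_apply] at this
    have h2 : (j : ℕ) < (Finset.univ.filter fun t => x (Tuple.sort x t) < v).card := by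
      convert this
    rw [hc] at h2
    omega
  rw [median, dif_pos hT]
  have h1 := key ⟨(T - 1) / 2, by omega⟩ (by simp only; omega)
  have h2 := key ⟨T / 2, by omega⟩ (by simp only; omega)
  linarith

/-! ### Counting independent events -/

section Count

variable {Ω : Type*} [MeasurableSpace Ω] {μ : Measure Ω} [IsProbabilityMeasure μ]

open Classical in
lemma measureReal_filter_eq {ι : Type*} {γ : ι → Type*} [∀ i, MeasurableSpace (γ i)]
    {f : ∀ i, Ω → γ i} (hf : ∀ i, Measurable (f i)) (hind : iIndepFun f μ) {A : ∀ i, Set (γ i)}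
    (hA : ∀ i, MeasurableSet (A i)) {p : ℝ} (G s : Finset ι) (hs : s ⊆ G)
    (hp : ∀ i ∈ G, μ.real {ω | f i ω ∈ A i} = p) :
    μ.real {ω | (G.filter fun i => f i ω ∈ A i) = s} = p ^ s.card * (1 - p) ^ (G.card - s.card) := by
  have e : {ω | (G.filter fun i => f i ω ∈ A i) = s}
      = ⋂ i ∈ G, f i ⁻¹' (if i ∈ s then A i else (A i)ᶜ) := by
    ext ω
    simp only [Set.mem_ofPred_eq, Set.mem_iInter, Set.mem_preimage, Finset.ext_iff,
      Finset.mem_filter]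
    constructor
    · intro h i hi
      by_cases his : i ∈ s
      · simpa [his] using ((h i).2 his).2
      · simpa [his] using fun hiA => his ((h i).1 ⟨hi, hiA⟩)
    · intro h i
      constructor
      · rintro ⟨hi, hiA⟩
        by_contra his
        have := h i hi
        simp [his] at this
        exact this hiA
      · intro his
        have := h i (hs his)
        simp only [his, if_true] at this
        exact ⟨hs his, this⟩
  rw [e, measureReal_def, hind.measure_inter_preimage_eq_mul G (fun i _ => by
    split_ifs
    · exact hA i
    · exact (hA i).compl), ENNReal.toReal_prod]
  have h2 : ∀ i ∈ G, (μ (f i ⁻¹' (if i ∈ s then A i else (A i)ᶜ))).toReal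
      = if i ∈ s then p else 1 - p := by
    intro i hi
    have hpi : μ.real (f i ⁻¹' A i) = p := hp i hi
    split_ifs
    · exact hpi
    · rw [Set.preimage_compl, ← measureReal_def, probReal_compl_eq_one_sub (hf i (hA i)), hpi]
  rw [Finset.prod_congr rfl h2, Finset.prod_ite, Finset.prod_const, Finset.prod_const,
    Finset.filter_mem_eq_inter, Finset.inter_eq_right.2 hs, ← Finset.sdiff_eq_filter,
    Finset.card_sdiff_of_subset hs]

-- The event splits according to the exact set of successes, and every set of size `j` has the same
-- probability by independence.
open Classical in
lemma measureReal_count_eq {ι : Type*} {γ : ι → Type*} [∀ i, MeasurableSpace (γ i)]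
    {f : ∀ i, Ω → γ i} (hf : ∀ i, Measurable (f i)) (hind : iIndepFun f μ) {A : ∀ i, Set (γ i)}
    (hA : ∀ i, MeasurableSet (A i)) {p : ℝ} (G : Finset ι)
    (hp : ∀ i ∈ G, μ.real {ω | f i ω ∈ A i} = p) (j : ℕ) :
    μ.real {ω | (G.filter fun i => f i ω ∈ A i).card = j} = binWeight G.card p j := by
  have hm : ∀ s : Finset ι, MeasurableSet {ω | (G.filter fun i => f i ω ∈ A i) = s} := by
    intro s
    by_cases hs : s ⊆ G
    · have e : {ω | (G.filter fun i => f i ω ∈ A i) = s}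
          = ⋂ i ∈ G, {ω | f i ω ∈ A i ↔ i ∈ s} := by
        ext ω
        simp only [Set.mem_ofPred_eq, Set.mem_iInter, Finset.ext_iff, Finset.mem_filter]
        exact ⟨fun h i hi => by rw [← h i]; simp [hi], fun h i =>
          ⟨fun hi => (h i hi.1).1 hi.2, fun hi => ⟨hs hi, (h i (hs hi)).2 hi⟩⟩⟩
      rw [e]
      refine Finset.measurableSet_biInter _ fun i _ => ?_
      by_cases his : i ∈ s
      · simp only [his, iff_true]
        exact hf i (hA i)
      · simp only [his, iff_false]
        exact hf i (hA i).compl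
    · convert MeasurableSet.empty
      ext ω
      simp only [Set.mem_ofPred_eq, Set.mem_empty_iff_false, iff_false]
      rintro rfl
      exact hs (Finset.filter_subset _ _)
  have e : {ω | (G.filter fun i => f i ω ∈ A i).card = j}
      = ⋃ s ∈ G.powersetCard j, {ω | (G.filter fun i => f i ω ∈ A i) = s} := by
    ext ω
    simp only [Set.mem_ofPred_eq, Set.mem_iUnion, Finset.mem_powersetCard, exists_prop]
    exact ⟨fun h => ⟨_, ⟨Finset.filter_subset _ _, h⟩, rfl⟩, fun ⟨s, hs, h⟩ => h ▸ hs.2⟩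
  rw [e, measureReal_biUnion_finset _ fun s _ => hm s]
  · rw [Finset.sum_congr rfl fun s hs => by
      rw [measureReal_filter_eq hf hind hA G s (Finset.mem_powersetCard.1 hs).1 hp,
        (Finset.mem_powersetCard.1 hs).2]]
    rw [Finset.sum_const, Finset.card_powersetCard, nsmul_eq_mul, binWeight, mul_assoc]
  · intro s _ s' _ hss
    refine Set.disjoint_left.2 fun ω h h' => hss ?_
    simp only [Set.mem_ofPred_eq] at h h'
    rw [← h, ← h']

/-! ### Moments and tails of a binomial variable. -/

variable {n : ℕ} {p : ℝ} {S : Ω → ℕ}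

lemma integral_comp_binomial (hS : Measurable S) (hle : ∀ ω, S ω ≤ n)
    (hlaw : ∀ i, μ.real {ω | S ω = i} = binWeight n p i) (g : ℕ → ℝ) :
    ∫ ω, g (S ω) ∂μ = ∑ i ∈ Finset.range (n + 1), binWeight n p i * g i := by
  have hm : ∀ i, MeasurableSet {ω | S ω = i} := fun i => hS (measurableSet_singleton i)
  have e : ∀ ω, g (S ω)
      = ∑ i ∈ Finset.range (n + 1), {ω | S ω = i}.indicator (fun _ => g i) ω := by
    intro ω
    rw [Finset.sum_eq_single (S ω)]
    · simp
    · intro i _ hi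
      simp [Ne.symm hi]
    · intro h
      exact absurd (Finset.mem_range.2 (Nat.lt_succ_of_le (hle ω))) h
  simp_rw [e]
  rw [integral_finsetSum _ fun i _ => (integrable_const _).indicator (hm i)]
  refine Finset.sum_congr rfl fun i _ => ?_
  rw [integral_indicator_const _ (hm i), hlaw, smul_eq_mul]

lemma integrable_comp_of_le (hS : Measurable S) (hle : ∀ ω, S ω ≤ n) (g : ℕ → ℝ) :
    Integrable (fun ω => g (S ω)) μ := by
  refine Integrable.of_bound (C := ∑ i ∈ Finset.range (n + 1), |g i|)
    (Measurable.of_discrete.comp hS).aestronglyMeasurable (ae_of_all _ fun ω => ?_)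
  exact Finset.single_le_sum (f := fun i => |g i|) (fun i _ => abs_nonneg _)
    (Finset.mem_range.2 (Nat.lt_succ_of_le (hle ω)))

lemma measureReal_le_binomial (hS : Measurable S) (hle : ∀ ω, S ω ≤ n)
    (hlaw : ∀ i, μ.real {ω | S ω = i} = binWeight n p i) {k : ℕ} (hk : k ≤ n) :
    μ.real {ω | S ω ≤ k} = binCdf n k p := by
  have hm : MeasurableSet {ω | S ω ≤ k} := hS measurableSet_Iic
  have h := integral_comp_binomial hS hle hlaw (fun i => if i ≤ k then 1 else 0)
  have e : (fun ω => if S ω ≤ k then (1 : ℝ) else 0) = {ω | S ω ≤ k}.indicator fun _ => 1 := by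
    ext ω; simp [Set.indicator_apply]
  rw [e, integral_indicator_const _ hm] at h
  simp only [smul_eq_mul, mul_one, mul_ite, mul_zero] at h
  rw [h, ← Finset.sum_filter, binCdf]
  congr 1
  ext i
  simp only [Finset.mem_filter, Finset.mem_range]
  omega

lemma measureReal_ge_binomial (hS : Measurable S) (hle : ∀ ω, S ω ≤ n)
    (hlaw : ∀ i, μ.real {ω | S ω = i} = binWeight n p i) {k : ℕ} (hk : k ≤ n) :
    μ.real {ω | k ≤ S ω} = binCdf n (n - k) (1 - p) := by
  have hm : Measurable fun ω => n - S ω := Measurable.of_discrete.comp hS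
  rw [← measureReal_le_binomial (μ := μ) (S := fun ω => n - S ω) hm (fun ω => Nat.sub_le _ _) ?_
    (Nat.sub_le _ _)]
  · congr 1
    ext ω
    have := hle ω
    simp only [Set.mem_ofPred_eq]
    omega
  · intro i
    by_cases hi : i ≤ n
    · have := binWeight_flip p (Nat.sub_le n i)
      rw [Nat.sub_sub_self hi] at this
      rw [this, ← hlaw]
      congr 1
      ext ω
      have := hle ω
      simp only [Set.mem_ofPred_eq]
      omega
    · have : {ω | n - S ω = i} = ∅ := by
        ext ω
        simp only [Set.mem_ofPred_eq, Set.mem_empty_iff_false, iff_false]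
        omega
      rw [this, measureReal_empty, binWeight, Nat.choose_eq_zero_of_lt (by omega)]
      simp

/-- Uses `exp l ≤ 1 + l + l²` for `|l| ≤ 1`. Any upper bound `M` on the mean is admitted, so that
for a count over the aligned clusters `M = T` can be taken. -/
lemma integral_exp_binomial_le (hS : Measurable S) (hle : ∀ ω, S ω ≤ n)
    (hlaw : ∀ i, μ.real {ω | S ω = i} = binWeight n p i) (h0 : 0 ≤ p) (h1 : p ≤ 1) {M l : ℝ}
    (hM : n * p ≤ M) (hl : |l| ≤ 1) :
    ∫ ω, Real.exp (l * (S ω - n * p)) ∂μ ≤ Real.exp (M * l ^ 2) := by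
  rw [integral_comp_binomial hS hle hlaw fun i => Real.exp (l * (i - n * p))]
  have e : ∀ i : ℕ, Real.exp (l * (i - n * p)) = Real.exp (l * i) * Real.exp (-(l * (n * p))) := by
    intro i; rw [← Real.exp_add]; ring_nf
  simp_rw [e, ← mul_assoc (binWeight _ _ _)]
  rw [← Finset.sum_mul, sum_binWeight_mul_exp]
  have h2 : p * Real.exp l + (1 - p) ≤ Real.exp (p * (l + l ^ 2)) := by
    have := (abs_le.1 (Real.abs_exp_sub_one_sub_id_le hl)).2
    have h3 := Real.add_one_le_exp (p * (l + l ^ 2))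
    nlinarith
  have h4 : 0 ≤ p * Real.exp l + (1 - p) := by
    have : 0 ≤ 1 - p := by linarith
    positivity
  calc (p * Real.exp l + (1 - p)) ^ n * Real.exp (-(l * (n * p)))
      ≤ Real.exp (p * (l + l ^ 2)) ^ n * Real.exp (-(l * (n * p))) := by gcongr
    _ = Real.exp (n * p * l ^ 2) := by
        rw [← Real.exp_nat_mul, ← Real.exp_add]; ring_nf
    _ ≤ Real.exp (M * l ^ 2) := by gcongr

/-- Chernoff's bound for both tails, `l` being a multiple of the sign of the tail. -/
lemma measureReal_exp_tail_le (hS : Measurable S) (hle : ∀ ω, S ω ≤ n)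
    (hlaw : ∀ i, μ.real {ω | S ω = i} = binWeight n p i) (h0 : 0 ≤ p) (h1 : p ≤ 1) {M y l : ℝ}
    (hM : n * p ≤ M) (hM0 : 0 < M) (hyM : y ≤ 2 * M) (hl : |l| = y / (2 * M)) :
    μ.real {ω | |l| * y ≤ l * (S ω - n * p)} ≤ Real.exp (-(y ^ 2 / (4 * M))) := by
  have hl1 : |l| ≤ 1 := by rw [hl, div_le_one (by positivity)]; exact hyM
  have hint := integrable_comp_of_le (μ := μ) hS hle fun i => Real.exp (l * (i - n * p))
  have hmarkov := mul_meas_ge_le_integral_of_nonneg (μ := μ)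
    (f := fun ω => Real.exp (l * (S ω - n * p))) (ae_of_all _ fun ω => (Real.exp_pos _).le) hint
    (Real.exp (|l| * y))
  simp only [Real.exp_le_exp] at hmarkov
  have h2 := hmarkov.trans (integral_exp_binomial_le hS hle hlaw h0 h1 hM hl1)
  have h3 : μ.real {ω | |l| * y ≤ l * (S ω - n * p)}
      ≤ Real.exp (M * l ^ 2) / Real.exp (|l| * y) := by
    rw [le_div_iff₀ (Real.exp_pos _), mul_comm]; exact h2
  refine h3.trans ?_
  rw [← Real.exp_sub, Real.exp_le_exp, ← sq_abs, hl]
  refine le_of_eq ?_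
  field_simp
  ring

lemma measureReal_upper_tail_le (hS : Measurable S) (hle : ∀ ω, S ω ≤ n)
    (hlaw : ∀ i, μ.real {ω | S ω = i} = binWeight n p i) (h0 : 0 ≤ p) (h1 : p ≤ 1) {M y : ℝ}
    (hM : n * p ≤ M) (hM0 : 0 < M) (hy : 0 ≤ y) (hyM : y ≤ 2 * M) :
    μ.real {ω | n * p + y ≤ S ω} ≤ Real.exp (-(y ^ 2 / (4 * M))) := by
  have hl : |y / (2 * M)| = y / (2 * M) := abs_of_nonneg (by positivity)
  refine (measureReal_mono ?_).trans
    (measureReal_exp_tail_le hS hle hlaw h0 h1 hM hM0 hyM hl)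
  intro ω hω
  simp only [Set.mem_ofPred_eq] at hω ⊢
  rw [hl]
  exact mul_le_mul_of_nonneg_left (by linarith) (by positivity)

lemma measureReal_lower_tail_le (hS : Measurable S) (hle : ∀ ω, S ω ≤ n)
    (hlaw : ∀ i, μ.real {ω | S ω = i} = binWeight n p i) (h0 : 0 ≤ p) (h1 : p ≤ 1) {M y : ℝ}
    (hM : n * p ≤ M) (hM0 : 0 < M) (hy : 0 ≤ y) (hyM : y ≤ 2 * M) :
    μ.real {ω | (S ω : ℝ) ≤ n * p - y} ≤ Real.exp (-(y ^ 2 / (4 * M))) := by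
  have hl : |-(y / (2 * M))| = y / (2 * M) := by rw [abs_neg]; exact abs_of_nonneg (by positivity)
  refine (measureReal_mono ?_).trans
    (measureReal_exp_tail_le hS hle hlaw h0 h1 hM hM0 hyM hl)
  intro ω hω
  simp only [Set.mem_ofPred_eq] at hω ⊢
  rw [hl, neg_mul, ← mul_neg]
  exact mul_le_mul_of_nonneg_left (by linarith) (by positivity)

lemma integral_binomial_div (hn : 0 < n) (hS : Measurable S) (hle : ∀ ω, S ω ≤ n)
    (hlaw : ∀ i, μ.real {ω | S ω = i} = binWeight n p i) : ∫ ω, (S ω / n : ℝ) ∂μ = p := by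
  have hn' : (n : ℝ) ≠ 0 := by positivity
  rw [integral_comp_binomial hS hle hlaw fun i => (i / n : ℝ)]
  simp_rw [← mul_div_assoc]
  rw [← Finset.sum_div, sum_binWeight_mul_id]
  field_simp

lemma integral_binomial_sq_le (hn : 0 < n) (hS : Measurable S) (hle : ∀ ω, S ω ≤ n)
    (hlaw : ∀ i, μ.real {ω | S ω = i} = binWeight n p i) (h0 : 0 ≤ p) :
    ∫ ω, (S ω / n - p : ℝ) ^ 2 ∂μ ≤ p / n := by
  have hn' : (0 : ℝ) < n := by exact_mod_cast hn
  rw [integral_comp_binomial hS hle hlaw fun i => (i / n - p : ℝ) ^ 2]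
  have e : ∀ i : ℕ, binWeight n p i * (i / n - p : ℝ) ^ 2
      = binWeight n p i * ((i : ℝ) - n * p) ^ 2 / (n : ℝ) ^ 2 := by
    intro i; field_simp
  simp_rw [e]
  rw [← Finset.sum_div, sum_binWeight_mul_sq, div_le_div_iff₀ (by positivity) hn']
  have : 0 ≤ p * n ^ 2 * p := by positivity
  nlinarith

end Count

end Shift

namespace Shift

/-! ### Risk of a single entry -/

/-- Stage II for a single entry, the hashed estimates of which are `x`. -/
noncomputable def fineTuneEntry {T : ℕ} (n : ℕ) (α : ℝ) (x : Fin T → ℝ) (t : Fin T) : ℝ :=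
  if |median x - x t| ≤ √(α * x t / n) then median x else x t

lemma abs_fineTuneEntry_sub_le {T : ℕ} (n : ℕ) (α : ℝ) (x : Fin T → ℝ) (t : Fin T) :
    |fineTuneEntry n α x t - x t| ≤ √(α * x t / n) := by
  unfold fineTuneEntry
  split_ifs with h
  · exact h
  · rw [sub_self, abs_zero]; exact Real.sqrt_nonneg _

/-- The counts `S t` of the clusters are independent binomial variables. -/
structure BinomialCounts {Ω : Type*} [MeasurableSpace Ω] (μ : Measure Ω) {T : ℕ} (n : ℕ)
    (β : Fin T → ℝ) (S : Fin T → Ω → ℕ) : Prop where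
  nonneg : ∀ t, 0 ≤ β t
  le_one : ∀ t, β t ≤ 1
  measurable : ∀ t, Measurable (S t)
  le : ∀ t ω, S t ω ≤ n
  law : ∀ t i, μ.real {ω | S t ω = i} = binWeight n (β t) i
  indep : iIndepFun S μ

variable {Ω : Type*} [MeasurableSpace Ω] {μ : Measure Ω} [IsProbabilityMeasure μ] {T n : ℕ}
  {β : Fin T → ℝ} {S : Fin T → Ω → ℕ}

/-- The error splits into the fine-tuning shift, whose square is at most `α x / n` with `x` the
local estimate of mean `β t`, and the local error, of variance at most `β t / n`. No information on
the other clusters is needed. -/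
lemma integral_sq_le_local (hS : BinomialCounts μ n β S) (hn : 0 < n) {α : ℝ} (hα : 0 ≤ α)
    (t : Fin T) {Z : Ω → ℝ}
    (hZ : ∀ ω, |Z ω| ≤ 2 * |fineTuneEntry n α (fun t' => (S t' ω / n : ℝ)) t - β t|) :
    ∫ ω, Z ω ^ 2 ∂μ ≤ 8 * (α + 1) * (β t / n) := by
  have hn' : (0 : ℝ) < n := by exact_mod_cast hn
  have hpt : ∀ ω, Z ω ^ 2 ≤ 8 * α / n * (S t ω / n) + 8 * (S t ω / n - β t) ^ 2 := by
    intro ω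
    have h1 := abs_fineTuneEntry_sub_le n α (fun t' => (S t' ω / n : ℝ)) t
    have h2 := hZ ω
    set F := fineTuneEntry n α (fun t' => (S t' ω / n : ℝ)) t
    set x : ℝ := S t ω / n
    have hx : 0 ≤ x := by positivity
    have h3 : (F - x) ^ 2 ≤ α * x / n := by
      rw [← sq_abs, ← Real.sq_sqrt (show 0 ≤ α * x / n by positivity)]
      exact pow_le_pow_left₀ (abs_nonneg _) h1 2
    have h4 : Z ω ^ 2 ≤ 4 * (F - β t) ^ 2 := by
      rw [← sq_abs, ← sq_abs (F - β t)]
      have := pow_le_pow_left₀ (abs_nonneg _) h2 2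
      linarith
    have h5 : 8 * α / n * x = 8 * (α * x / n) := by ring
    nlinarith [sq_nonneg (F - x - (x - β t))]
  have i1 := integrable_comp_of_le (μ := μ) (hS.measurable t) (hS.le t) fun i => (i / n : ℝ)
  have i2 := integrable_comp_of_le (μ := μ) (hS.measurable t) (hS.le t)
    fun i => (i / n - β t : ℝ) ^ 2
  refine (integral_mono_of_nonneg (ae_of_all _ fun ω => sq_nonneg _)
    ((i1.const_mul _).add (i2.const_mul _)) (ae_of_all _ hpt)).trans ?_
  rw [integral_add' (i1.const_mul _) (i2.const_mul _), integral_const_mul, integral_const_mul,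
    integral_binomial_div hn (hS.measurable t) (hS.le t) (hS.law t)]
  have := integral_binomial_sq_le hn (hS.measurable t) (hS.le t) (hS.law t) (hS.nonneg t)
  have e : 8 * (α + 1) * (β t / n) = 8 * α / n * β t + 8 * (β t / n) := by ring
  rw [e]
  linarith

open Classical in
/-- If an event has probability at least `1 / 2 + δ` in all the clusters but a few, then it occurs
in more than half of the clusters with high probability. -/
lemma measureReal_not_majority_le (hS : BinomialCounts μ n β S) (hT : 0 < T) {b a δ : ℝ}
    (A : ℕ → Prop) [DecidablePred A] (ha : ∀ t, β t = b → μ.real {ω | A (S t ω)} = a) (ha0 : 1 / 2 + δ ≤ a) (ha1 : a ≤ 1)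
    (hδ0 : 0 ≤ δ) (hδ : δ ≤ 1 / 8)
    (hm : 2 * ((Finset.univ.filter fun t => β t ≠ b).card : ℝ) ≤ δ * T) :
    μ.real {ω | 2 * (Finset.univ.filter fun t => A (S t ω)).card ≤ T}
      ≤ Real.exp (-(T * δ ^ 2 / 16)) := by
  set G : Finset (Fin T) := Finset.univ.filter fun t => β t = b
  set m := (Finset.univ.filter fun t => β t ≠ b).card
  have hT' : (0 : ℝ) < T := by exact_mod_cast hT
  have hGm : (G.card : ℝ) = T - m := by
    have : G.card + m = T := by
      simpa using Finset.card_filter_add_card_filter_not (s := (Finset.univ : Finset (Fin T)))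
        (p := fun t => β t = b)
    have : (G.card : ℝ) + m = T := by exact_mod_cast this
    linarith
  have hlaw : ∀ j, μ.real {ω | (G.filter fun t => A (S t ω)).card = j} = binWeight G.card a j := by
    intro j
    convert measureReal_count_eq (μ := μ) hS.measurable hS.indep (A := fun _ => {i | A i})
      (fun _ => MeasurableSet.of_discrete) G (p := a)
      (fun t ht => ha t (Finset.mem_filter.1 ht).2) j
    exact Iff.rfl
  have hmeas : Measurable fun ω => (G.filter fun t => A (S t ω)).card := by
    have : (fun ω => (G.filter fun t => A (S t ω)).card)
        = fun ω => ∑ t ∈ G, if A (S t ω) then 1 else 0 := by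
      funext ω; rw [Finset.card_filter]
    rw [this]
    exact Finset.measurable_sum _ fun t _ =>
      (Measurable.of_discrete (f := fun i : ℕ => if A i then (1 : ℕ) else 0)).comp (hS.measurable t)
  have hm0 : (0 : ℝ) ≤ m := by positivity
  -- Only the `T - m` clusters with mean `b` are counted. Their expected count exceeds `T/2` by at
  -- least `T δ - 5m/8`, hence by `T δ / 2` since `2m ≤ δ T`.
  have htail := measureReal_lower_tail_le (μ := μ) hmeas (fun ω => Finset.card_filter_le _ _) hlaw
    (by linarith) ha1 (M := T) (y := T * δ / 2) (by rw [hGm]; nlinarith) hT' (by positivity)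
    (by nlinarith)
  have e : (T * δ / 2) ^ 2 / (4 * (T : ℝ)) = T * δ ^ 2 / 16 := by field_simp; ring
  rw [e] at htail
  refine (measureReal_mono ?_).trans htail
  intro ω hω
  simp only [Set.mem_ofPred_eq] at hω ⊢
  have hsub : (G.filter fun t => A (S t ω)).card ≤ (Finset.univ.filter fun t => A (S t ω)).card :=
    Finset.card_le_card fun t ht =>
      Finset.mem_filter.2 ⟨Finset.mem_univ _, (Finset.mem_filter.1 ht).2⟩
  have h2 : 2 * ((G.filter fun t => A (S t ω)).card : ℝ) ≤ T := by
    exact_mod_cast (by omega : 2 * (G.filter fun t => A (S t ω)).card ≤ T)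
  have h3 : (T - m : ℝ) * (1 / 2 + δ) ≤ (T - m) * a :=
    mul_le_mul_of_nonneg_left ha0 (by nlinarith)
  rw [hGm]
  have h4 : δ * m ≤ 1 / 8 * m := mul_le_mul_of_nonneg_right hδ hm0
  linarith

/-- If most of the counts and the count of cluster `t` are close to `n * b`, then the estimate of
cluster `t` is the median. -/
lemma fineTuneEntry_eq_median {α b δ r s : ℝ} {t : Fin T} {σ : Fin T → ℕ} {ku kl : ℕ} (hn : 0 < n)
    (hα : 2 * (8 + r) ^ 2 ≤ α) (hb0 : 0 ≤ b) (hsq : s ^ 2 = n * b) (hr0 : 0 ≤ r)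
    (hrs1 : r * s ≤ n * b / 2) (h1 : T < 2 * (Finset.univ.filter fun t => σ t ≤ ku).card)
    (h2 : T < 2 * (Finset.univ.filter fun t => kl ≤ σ t).card)
    (hku : (ku : ℝ) ≤ n * b + 16 * δ * s + 1) (hkl : n * b - 16 * δ * s - 1 ≤ kl)
    (h3 : σ t < n * b + r * s) (h4 : n * b - r * s < σ t) (hδs : 16 * δ * s + 1 ≤ 8 * s) :
    fineTuneEntry n α (fun t' => (σ t' / n : ℝ)) t = median (fun t' => (σ t' / n : ℝ)) ∧
      |median (fun t' => (σ t' / n : ℝ)) - b| ≤ (16 * δ * s + 1) / n := by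
  have hn0 : (0 : ℝ) < n := by exact_mod_cast hn
  set x : Fin T → ℝ := fun t' => (σ t' / n : ℝ) with hx
  have hmed1 : median x ≤ ku / n := by
    refine median_le ?_
    have : (Finset.univ.filter fun t' => x t' ≤ ku / n)
        = Finset.univ.filter fun t' => σ t' ≤ ku := by
      ext t'
      simp [hx, div_le_div_iff_of_pos_right hn0]
    rwa [this]
  have hmed2 : kl / n ≤ median x := by
    refine le_median ?_
    have : (Finset.univ.filter fun t' => kl / n ≤ x t')
        = Finset.univ.filter fun t' => kl ≤ σ t' := by
      ext t'
      simp [hx, div_le_div_iff_of_pos_right hn0]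
    rwa [this]
  have hup : median x - b ≤ (16 * δ * s + 1) / n := by
    have : (ku : ℝ) / n - b ≤ (16 * δ * s + 1) / n := by
      rw [div_sub' hn0.ne', div_le_div_iff_of_pos_right hn0]; linarith
    linarith
  have hlo : -((16 * δ * s + 1) / n) ≤ median x - b := by
    have : -((16 * δ * s + 1) / n) ≤ (kl : ℝ) / n - b := by
      rw [div_sub' hn0.ne', ← neg_div, div_le_div_iff_of_pos_right hn0]; linarith
    linarith
  have hmed : |median x - b| ≤ (16 * δ * s + 1) / n := abs_le.2 ⟨hlo, hup⟩
  have hxt : |b - x t| ≤ r * s / n := by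
    rw [hx]
    simp only
    rw [sub_div' hn0.ne', abs_div, abs_of_pos hn0, div_le_div_iff_of_pos_right hn0, abs_le]
    constructor <;> linarith
  have hthr : |median x - x t| ≤ √(α * x t / n) := by
    have htri := abs_sub_le (median x) b (x t)
    refine Real.le_sqrt_of_sq_le ?_
    have h5 : |median x - x t| ≤ (8 + r) * s / n := by
      refine (htri.trans (add_le_add hmed hxt)).trans ?_
      rw [← add_div, div_le_div_iff_of_pos_right hn0]
      linarith
    refine (pow_le_pow_left₀ (abs_nonneg _) h5 2).trans ?_
    have h6 : α * x t / n = α * σ t / n ^ 2 := by rw [hx]; field_simp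
    -- The factor 2 in the lower bound on `α` compensates for the local estimate, known only to be
    -- at least `b / 2`.
    rw [h6, div_pow, div_le_div_iff_of_pos_right (by positivity), mul_pow, hsq]
    have h7 : n * b / 2 ≤ σ t := by linarith
    have h8 : 2 * (8 + r) ^ 2 * (n * b / 2) ≤ α * σ t :=
      mul_le_mul hα h7 (by positivity) ((by positivity : 0 ≤ 2 * (8 + r) ^ 2).trans hα)
    linarith
  exact ⟨if_pos hthr, hmed⟩

set_option maxHeartbeats 1000000 in
open Classical in
/-- The main estimate for an entry at which most clusters, and cluster `t`, agree. -/
lemma integral_sq_le_of_large (hS : BinomialCounts μ n β S) (hn : 2 ≤ n) {α b δ : ℝ}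
    (hα : 2 * (8 + √(8 * Real.log n)) ^ 2 ≤ α) {t : Fin T} (ht : β t = b)
    (hb : 64 * Real.log n ≤ n * b) (hδ0 : 0 ≤ δ) (hδ : δ ≤ 1 / 8)
    (hm : 2 * ((Finset.univ.filter fun t => β t ≠ b).card : ℝ) ≤ δ * T)
    (hTδ : 32 * Real.log n ≤ T * δ ^ 2) {Z : Ω → ℝ}
    (hZ1 : ∀ ω, |Z ω| ≤ 1)
    (hZ : ∀ ω, |Z ω| ≤ 2 * |fineTuneEntry n α (fun t' => (S t' ω / n : ℝ)) t - β t|) :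
    ∫ ω, Z ω ^ 2 ∂μ ≤ 2048 * δ ^ 2 * (b / n) + 12 / n ^ 2 := by
  have hn' : (2 : ℝ) ≤ n := by exact_mod_cast hn
  have hT : 0 < T := t.pos
  have hlog : 1 / 2 ≤ Real.log n := by
    have := Real.log_two_gt_d9
    have := Real.log_le_log (by norm_num) hn'
    linarith
  set L := Real.log n
  have hb0 : 0 ≤ b := ht ▸ hS.nonneg t
  have hb1 : b ≤ 1 := ht ▸ hS.le_one t
  obtain ⟨ku, hkun, hku, hPu⟩ := exists_upper_quantile (n := n) (p := b) (by omega) hb0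
    (by linarith) hδ0 hδ
  obtain ⟨kl, hkln, hkl, hPl⟩ := exists_lower_quantile (n := n) (p := b) (by omega) hb1
    (by linarith) hδ0 hδ
  have hs2 : 2 ≤ √(n * b) := Real.le_sqrt_of_sq_le (by linarith)
  have hsq : √(n * b) ^ 2 = n * b := Real.sq_sqrt (by linarith)
  have hr0 : 0 ≤ √(8 * L) := Real.sqrt_nonneg _
  have hrsq : √(8 * L) ^ 2 = 8 * L := Real.sq_sqrt (by linarith)
  set s := √(n * b)
  set r := √(8 * L)
  have hexp : Real.exp (-(2 * L)) = 1 / (n : ℝ) ^ 2 := by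
    rw [Real.exp_neg, two_mul, Real.exp_add, Real.exp_log (by linarith)]
    field_simp
  have hmaj : Real.exp (-(T * δ ^ 2 / 16)) ≤ 1 / (n : ℝ) ^ 2 := by
    rw [← hexp, Real.exp_le_exp]; linarith
  set E1 : Set Ω := {ω | 2 * (Finset.univ.filter fun t => S t ω ≤ ku).card ≤ T}
  set E2 : Set Ω := {ω | 2 * (Finset.univ.filter fun t => kl ≤ S t ω).card ≤ T}
  set E3 : Set Ω := {ω | n * b + r * s ≤ S t ω}
  set E4 : Set Ω := {ω | (S t ω : ℝ) ≤ n * b - r * s}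
  have hE1 : μ.real E1 ≤ 1 / (n : ℝ) ^ 2 := by
    have h := fun t' (h : β t' = b) => measureReal_le_binomial (μ := μ) (hS.measurable t') (hS.le t')
      (h ▸ hS.law t') hkun
    exact (measureReal_not_majority_le hS hT (fun i => i ≤ ku) h hPu (h t ht ▸ measureReal_le_one) hδ0 hδ
      hm).trans hmaj
  have hE2 : μ.real E2 ≤ 1 / (n : ℝ) ^ 2 := by
    have h := fun t' (h : β t' = b) => measureReal_ge_binomial (μ := μ) (hS.measurable t') (hS.le t')
      (h ▸ hS.law t') hkln
    exact (measureReal_not_majority_le hS hT (fun i => kl ≤ i) h hPl (h t ht ▸ measureReal_le_one) hδ0 hδ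
      hm).trans hmaj
  have hrs : r ≤ s / 2 := by
    have : r ^ 2 ≤ (s / 2) ^ 2 := by
      rw [hrsq, div_pow, hsq]; linarith
    exact le_of_sq_le_sq this (by linarith)
  have hrs0 : 0 ≤ r * s := by positivity
  have hrs1 : r * s ≤ n * b / 2 := by rw [← hsq]; nlinarith
  -- The value `r = √(8 log n)` is chosen so that Chernoff's exponent at deviation `r √(nb)` is `2
  -- log n`.
  have he : (r * s) ^ 2 / (4 * (n * b)) = 2 * L := by
    rw [mul_pow, hrsq, ← hsq]; field_simp; ring
  have hlawt : ∀ i, μ.real {ω | S t ω = i} = binWeight n b i := ht ▸ hS.law t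
  have hE3 : μ.real E3 ≤ 1 / (n : ℝ) ^ 2 := by
    have := measureReal_upper_tail_le (μ := μ) (hS.measurable t) (hS.le t) hlawt hb0 hb1
      le_rfl (by linarith) hrs0 (by linarith)
    rwa [he, hexp] at this
  have hE4 : μ.real E4 ≤ 1 / (n : ℝ) ^ 2 := by
    have := measureReal_lower_tail_le (μ := μ) (hS.measurable t) (hS.le t) hlawt hb0 hb1
      le_rfl (by linarith) hrs0 (by linarith)
    rwa [he, hexp] at this
  have hEm : MeasurableSet (E1 ∪ E2 ∪ E3 ∪ E4) := by
    have hSm : Measurable fun ω t' => S t' ω := measurable_pi_lambda _ hS.measurable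
    exact hSm (t := {σ : Fin T → ℕ | ((2 * (Finset.univ.filter fun t => σ t ≤ ku).card ≤ T
      ∨ 2 * (Finset.univ.filter fun t => kl ≤ σ t).card ≤ T)
      ∨ n * b + r * s ≤ σ t) ∨ (σ t : ℝ) ≤ n * b - r * s}) MeasurableSet.of_discrete
  have hE : μ.real (E1 ∪ E2 ∪ E3 ∪ E4) ≤ 4 / (n : ℝ) ^ 2 := by
    have h1 := measureReal_union_le (μ := μ) (E1 ∪ E2 ∪ E3) E4
    have h2 := measureReal_union_le (μ := μ) (E1 ∪ E2) E3
    have h3 := measureReal_union_le (μ := μ) E1 E2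
    have : 4 / (n : ℝ) ^ 2 = 4 * (1 / (n : ℝ) ^ 2) := by ring
    linarith
  have hn0 : (0 : ℝ) < n := by linarith
  have hδs : δ * s ≤ s / 8 := by nlinarith
  have hδs0 : 0 ≤ δ * s := by positivity
  -- Off the four bad events the estimate is the median, with quantile accuracy; on them the error
  -- is at most 1, which costs their total probability `4 / n²`.
  have hpt : ∀ ω, Z ω ^ 2 ≤ 4 * ((16 * δ * s + 1) / n) ^ 2
      + (E1 ∪ E2 ∪ E3 ∪ E4).indicator (fun _ => (1 : ℝ)) ω := by
    intro ω
    by_cases hω : ω ∈ E1 ∪ E2 ∪ E3 ∪ E4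
    · rw [Set.indicator_of_mem hω, ← sq_abs]
      have := pow_le_one₀ (n := 2) (abs_nonneg _) (hZ1 ω)
      have : 0 ≤ 4 * ((16 * δ * s + 1) / n) ^ 2 := by positivity
      linarith
    rw [Set.indicator_of_notMem hω, add_zero]
    simp only [E1, E2, E3, E4, Set.mem_union, Set.mem_ofPred_eq, not_or, not_le] at hω
    obtain ⟨⟨⟨h1, h2⟩, h3⟩, h4⟩ := hω
    obtain ⟨hF, hmed⟩ := fineTuneEntry_eq_median (by omega) hα hb0 hsq hr0
      (by linarith) h1 h2 hku hkl h3 h4 (by linarith)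
    have h9 := hZ ω
    rw [hF, ht] at h9
    rw [← sq_abs]
    have := pow_le_pow_left₀ (abs_nonneg _) (h9.trans (mul_le_mul_of_nonneg_left hmed zero_le_two)) 2
    linarith
  have hind : Integrable ((E1 ∪ E2 ∪ E3 ∪ E4).indicator fun _ => (1 : ℝ)) μ :=
    (integrable_const _).indicator hEm
  refine (integral_mono_of_nonneg (ae_of_all _ fun ω => sq_nonneg _)
    ((integrable_const _).add hind) (ae_of_all _ hpt)).trans ?_
  rw [integral_add' (integrable_const _) hind, integral_indicator_const _ hEm, integral_const]
  simp only [probReal_univ, smul_eq_mul, one_mul, mul_one]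
  have hfin : 4 * ((16 * δ * s + 1) / n) ^ 2 ≤ 2048 * δ ^ 2 * (b / n) + 8 / n ^ 2 := by
    have e : 2048 * δ ^ 2 * (b / n) + 8 / n ^ 2 = (2048 * (δ ^ 2 * s ^ 2) + 8) / n ^ 2 := by
      rw [hsq]; field_simp
    rw [e, div_pow, ← mul_div_assoc, div_le_div_iff_of_pos_right (by positivity)]
    nlinarith [sq_nonneg (16 * δ * s - 1)]
  have : 12 / (n : ℝ) ^ 2 = 8 / n ^ 2 + 4 / n ^ 2 := by ring
  linarith

set_option maxHeartbeats 1000000 in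
open Classical in
/-- The risk of an entry at which cluster `t` has the central mean `b`. -/
lemma integral_sq_le_aligned (hS : BinomialCounts μ n β S) (hn : 2 ≤ n) {α b : ℝ}
    (hα : 2 * (8 + √(8 * Real.log n)) ^ 2 ≤ α) {t : Fin T} (ht : β t = b) {Z : Ω → ℝ}
    (hZ1 : ∀ ω, |Z ω| ≤ 1)
    (hZ : ∀ ω, |Z ω| ≤ 2 * |fineTuneEntry n α (fun t' => (S t' ω / n : ℝ)) t - β t|) :
    ∫ ω, Z ω ^ 2 ∂μ ≤ 16384 * α ^ 2 *
      (((Finset.univ.filter fun t => β t ≠ b).card : ℝ) ^ 2 * b / (T ^ 2 * n)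
        + b / (T * n) + 1 / n ^ 2) := by
  have hn' : (2 : ℝ) ≤ n := by exact_mod_cast hn
  have hn0 : (0 : ℝ) < n := by linarith
  have hT : (0 : ℝ) < T := by exact_mod_cast t.pos
  have hL : 0 ≤ Real.log n := Real.log_nonneg (by linarith)
  have hr0 : 0 ≤ √(8 * Real.log n) := Real.sqrt_nonneg _
  have hrsq : √(8 * Real.log n) ^ 2 = 8 * Real.log n := Real.sq_sqrt (by linarith)
  have hα1 : 128 ≤ α := by nlinarith
  have hαL : 16 * Real.log n ≤ α := by nlinarith
  set L := Real.log n
  set m := (Finset.univ.filter fun t => β t ≠ b).card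
  have hb0 : 0 ≤ b := ht ▸ hS.nonneg t
  have hlocal := integral_sq_le_local hS (by omega) (by linarith) t hZ
  rw [ht] at hlocal
  have hbn : 0 ≤ b / n := by positivity
  have hlocal' : ∫ ω, Z ω ^ 2 ∂μ ≤ 16 * α * (b / n) :=
    hlocal.trans (mul_le_mul_of_nonneg_right (by linarith) hbn)
  have hα0 : 0 < α := by linarith
  have q1 : 0 ≤ (m : ℝ) ^ 2 * b / (T ^ 2 * n) := by positivity
  have q2 : 0 ≤ b / (T * n) := by positivity
  have q3 : 0 ≤ 1 / (n : ℝ) ^ 2 := by positivity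
  -- In three degenerate cases the local bound `16 α b / n` suffices, each being absorbed by one
  -- term of the target: a small mean by `1 / n²`, few clusters by `b / (T n)`, many deviating
  -- clusters by `m² b / (T² n)`.
  rcases lt_or_ge (n * b) (64 * L) with hb | hb
  · have h1 : b / n ≤ 4 * α * (1 / n ^ 2) := by
      have : b / n = n * b / n ^ 2 := by field_simp
      rw [this, mul_one_div, div_le_div_iff_of_pos_right (by positivity)]
      linarith
    have h2 : 16 * α * (b / n) ≤ 16 * α * (4 * α * (1 / n ^ 2)) :=
      mul_le_mul_of_nonneg_left h1 (by linarith)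
    have h3 : 0 ≤ α ^ 2 * (1 / (n : ℝ) ^ 2) := by positivity
    have h4 := mul_nonneg (sq_nonneg α) q1
    have h5 := mul_nonneg (sq_nonneg α) q2
    linarith
  rcases lt_or_ge (T : ℝ) (8192 * L) with hTL | hTL
  · have h1 : b / n ≤ 512 * α * (b / (T * n)) := by
      have : b / n = T * (b / (T * n)) := by field_simp
      rw [this]
      exact mul_le_mul_of_nonneg_right (by linarith) q2
    have h2 : 16 * α * (b / n) ≤ 16 * α * (512 * α * (b / (T * n))) :=
      mul_le_mul_of_nonneg_left h1 (by linarith)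
    have h3 := mul_nonneg (sq_nonneg α) q3
    have h4 := mul_nonneg (sq_nonneg α) q1
    have h5 := mul_nonneg (sq_nonneg α) q2
    linarith
  rcases lt_or_ge (T : ℝ) (32 * m) with hTm | hTm
  · have h1 : b / n ≤ 1024 * ((m : ℝ) ^ 2 * b / (T ^ 2 * n)) := by
      have : b / n = T ^ 2 * (b / (T ^ 2 * n)) := by field_simp
      rw [this]
      have h : (T : ℝ) ^ 2 ≤ 1024 * m ^ 2 := by
        have := pow_le_pow_left₀ hT.le hTm.le 2
        linarith
      have := mul_le_mul_of_nonneg_right h (show 0 ≤ b / ((T : ℝ) ^ 2 * n) by positivity)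
      refine this.trans (le_of_eq ?_)
      ring
    have h2 : 16 * α * (b / n) ≤ 16 * α * (1024 * ((m : ℝ) ^ 2 * b / (T ^ 2 * n))) :=
      mul_le_mul_of_nonneg_left h1 (by linarith)
    have h2' : α * ((m : ℝ) ^ 2 * b / (T ^ 2 * n)) ≤ α ^ 2 * ((m : ℝ) ^ 2 * b / (T ^ 2 * n)) :=
      mul_le_mul_of_nonneg_right (by nlinarith) q1
    have h3 := mul_nonneg (sq_nonneg α) q3
    have h5 := mul_nonneg (sq_nonneg α) q2
    linarith
  · have hsq : √(32 * L / T) ^ 2 = 32 * L / T := Real.sq_sqrt (by positivity)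
    have hs0 : 0 ≤ √(32 * L / T) := Real.sqrt_nonneg _
    have hs1 : √(32 * L / T) ≤ 1 / 16 := by
      rw [Real.sqrt_le_iff]
      refine ⟨by norm_num, ?_⟩
      rw [div_le_iff₀ hT]; linarith
    have hm1 : 2 * (m : ℝ) / T ≤ 1 / 16 := by rw [div_le_iff₀ hT]; linarith
    have hm0 : 0 ≤ 2 * (m : ℝ) / T := by positivity
    -- The first summand of `δ` outweighs the deviating clusters, the second makes the majority fail
    -- with probability at most `1 / n²`; the excluded cases make each at most `1/16`.
    have h := integral_sq_le_of_large hS hn hα (δ := 2 * m / T + √(32 * L / T)) ht hb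
      (by linarith) (by linarith) ?_ ?_ hZ1 hZ
    · refine h.trans ?_
      have h1 : (2 * m / T + √(32 * L / T)) ^ 2 ≤ 8 * m ^ 2 / T ^ 2 + 4 * α / T := by
        have a1 : (2 * m / T + √(32 * L / T)) ^ 2
            ≤ 2 * (2 * m / T : ℝ) ^ 2 + 2 * √(32 * L / T) ^ 2 := by
          nlinarith [sq_nonneg (2 * m / T - √(32 * L / T))]
        have a2 : 2 * √(32 * L / T) ^ 2 ≤ 4 * α / T := by
          rw [hsq, ← mul_div_assoc, div_le_div_iff_of_pos_right hT]; linarith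
        have a3 : 2 * (2 * m / T : ℝ) ^ 2 = 8 * m ^ 2 / T ^ 2 := by ring
        linarith
      have h2 : 2048 * (2 * m / T + √(32 * L / T)) ^ 2 * (b / n)
          ≤ 2048 * (8 * m ^ 2 / T ^ 2 + 4 * α / T) * (b / n) :=
        mul_le_mul_of_nonneg_right (by linarith) hbn
      have h3 : 2048 * (8 * m ^ 2 / T ^ 2 + 4 * α / T) * (b / n)
          = 16384 * ((m : ℝ) ^ 2 * b / (T ^ 2 * n)) + 8192 * α * (b / (T * n)) := by
        field_simp; ring
      have hα2 : 1 ≤ α ^ 2 := by nlinarith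
      have hα3 : α ≤ α ^ 2 := by nlinarith
      have h4 := mul_le_mul_of_nonneg_right hα2 q1
      have h5 := mul_le_mul_of_nonneg_right hα3 q2
      have h5' := mul_nonneg (sq_nonneg α) q2
      have h6 := mul_le_mul_of_nonneg_right hα2 q3
      have h7 : 12 / (n : ℝ) ^ 2 = 12 * (1 / n ^ 2) := by ring
      rw [h7]
      linarith
    · have : (2 * m / T + √(32 * L / T)) * T = 2 * m + √(32 * L / T) * T := by
        field_simp
      rw [this]
      have : 0 ≤ √(32 * L / T) * T := by positivity
      linarith
    · have h1 : √(32 * L / T) ^ 2 ≤ (2 * m / T + √(32 * L / T)) ^ 2 :=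
        pow_le_pow_left₀ hs0 (by linarith) 2
      have h2 := mul_le_mul_of_nonneg_left h1 hT.le
      rw [hsq] at h2
      have : (T : ℝ) * (32 * L / T) = 32 * L := by field_simp
      linarith

end Shift

namespace Shift

/-! ### From the data model to binomial counts -/

/-- Overwriting the value at `x` of a colliding function by an arbitrary one gives a bijection onto
all functions. -/
lemma card_collision {d N : ℕ} {k x : Fin d} (hkx : k ≠ x) :
    (Finset.univ.filter fun g : Fin d → Fin N => g k = g x).card * N = N ^ d := by
  have h : ((Finset.univ.filter fun g : Fin d → Fin N => g k = g x) ×ˢ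
      (Finset.univ : Finset (Fin N))).card = (Finset.univ : Finset (Fin d → Fin N)).card := by
    refine Finset.card_bij' (fun gv _ => Function.update gv.1 x gv.2)
      (fun g _ => (Function.update g x (g k), g x)) ?_ ?_ ?_ ?_
    · intros; exact Finset.mem_univ _
    · intro g _
      simp [Function.update_of_ne hkx]
    · rintro ⟨g, v⟩ hg
      simp only [Finset.mem_product, Finset.mem_filter, Finset.mem_univ, true_and, and_true] at hg
      simp [Function.update_of_ne hkx, hg]
    · intro g _
      simp
  rw [Finset.card_product, Finset.card_univ, Finset.card_univ] at h
  simpa using h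

/-- Clipping to `[0, 1]` does not increase the distance to `v`, and the affine map has slope `2 ^ b
/ (2 ^ b - 1) ≤ 2` because `b ≥ 1`. -/
lemma abs_debias_sub_le {b : ℕ} (hb : 1 ≤ b) {v : ℝ} (h0 : 0 ≤ v) (h1 : v ≤ 1) (x : ℝ) :
    |debias b x - v| ≤ 1 ∧ |debias b x - v| ≤ 2 * |x - ((2 ^ b - 1) * v + 1) / 2 ^ b| := by
  have hN : (2 : ℝ) ≤ 2 ^ b := by
    calc (2 : ℝ) = 2 ^ 1 := by norm_num
      _ ≤ 2 ^ b := pow_le_pow_right₀ one_le_two hb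
  have hN1 : (0 : ℝ) < 2 ^ b - 1 := by linarith
  set N : ℝ := 2 ^ b
  set z := (N * x - 1) / (N - 1) with hz
  have hd : debias b x = max 0 (min 1 z) := rfl
  have hclip : |max 0 (min 1 z) - v| ≤ |z - v| := by
    rcases max_cases 0 (min 1 z) with ⟨e, _⟩ | ⟨e, _⟩ <;>
      rcases min_cases 1 z with ⟨e', _⟩ | ⟨e', _⟩ <;> rw [e] <;> simp only [e'] at * <;>
      cases abs_cases (z - v) <;> rw [abs_le] <;> constructor <;> linarith
  constructor
  · rw [hd, abs_le]
    have a1 : 0 ≤ max 0 (min 1 z) := le_max_left _ _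
    have a2 : max 0 (min 1 z) ≤ 1 := max_le zero_le_one (min_le_left _ _)
    constructor <;> linarith
  · rw [hd]
    refine hclip.trans ?_
    have e : z - v = N / (N - 1) * (x - ((N - 1) * v + 1) / N) := by
      rw [hz]; field_simp; ring
    rw [e, abs_mul, abs_of_pos (by positivity)]
    refine mul_le_mul_of_nonneg_right ?_ (abs_nonneg _)
    rw [div_le_iff₀ hN1]; linarith

section

variable {Ω : Type*} [MeasurableSpace Ω] {μ : Measure Ω} [IsProbabilityMeasure μ]

/-- Conditionally on `X = x`, the hashes of `k` and `x` agree surely if `x = k` and with probability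
`1 / 2 ^ b` otherwise. -/
lemma measureReal_collision {d b : ℕ} {p : Fin d → ℝ} (hp : ∑ x, p x = 1) {X : Ω → Fin d}
    {h : Ω → Fin d → Fin (2 ^ b)} (hX : Measurable X) (hh : Measurable h) (hXh : IndepFun X h μ)
    (lX : ∀ k, μ.real {ω | X ω = k} = p k)
    (lh : ∀ g, μ.real {ω | h ω = g} = 1 / ((2 : ℝ) ^ b) ^ d) (k : Fin d) :
    μ.real {ω | h ω k = h ω (X ω)} = hashedMean b p k := by
  have hhk : ∀ x, μ.real {ω | h ω k = h ω x} = if x = k then 1 else 1 / (2 : ℝ) ^ b := by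
    intro x
    split_ifs with hx
    · simp [hx]
    · have e : {ω | h ω k = h ω x}
          = ⋃ g ∈ Finset.univ.filter fun g : Fin d → Fin (2 ^ b) => g k = g x, {ω | h ω = g} := by
        ext ω; simp
      rw [e, measureReal_biUnion_finset, Finset.sum_congr rfl fun g _ => lh g, Finset.sum_const,
        nsmul_eq_mul]
      · have := card_collision (N := 2 ^ b) (k := k) (x := x) (Ne.symm hx)
        have h2 : ((Finset.univ.filter fun g : Fin d → Fin (2 ^ b) => g k = g x).card : ℝ) * 2 ^ b
          = (2 ^ b) ^ d := by exact_mod_cast this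
        rw [← h2]
        have : ((Finset.univ.filter fun g : Fin d → Fin (2 ^ b) => g k = g x).card : ℝ) ≠ 0 := by
          intro h0
          rw [h0, zero_mul] at h2
          exact (by positivity : ((2 : ℝ) ^ b) ^ d ≠ 0) h2.symm
        field_simp
      · intro g _ g' _ hgg
        refine Set.disjoint_left.2 fun ω h1 h2 => hgg ?_
        simp only [Set.mem_ofPred_eq] at h1 h2
        rw [← h1, ← h2]
      · exact fun g _ => hh (measurableSet_singleton g)
  have e : {ω | h ω k = h ω (X ω)}
      = ⋃ x ∈ (Finset.univ : Finset (Fin d)), ({ω | X ω = x} ∩ {ω | h ω k = h ω x}) := by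
    ext ω; simp
  rw [e, measureReal_biUnion_finset]
  · have hx : ∀ x, μ.real ({ω | X ω = x} ∩ {ω | h ω k = h ω x})
        = p x * if x = k then 1 else 1 / (2 : ℝ) ^ b := by
      intro x
      rw [← hhk x, ← lX x, measureReal_def, measureReal_def, measureReal_def, ← ENNReal.toReal_mul]
      congr 1
      exact hXh.measure_inter_preimage_eq_mul {x} {g | g k = g x} (measurableSet_singleton x)
        MeasurableSet.of_discrete
    simp_rw [hx]
    have hs : ∑ x, p x * (if x = k then 1 else 1 / (2 : ℝ) ^ b)
        = ∑ x, (p x * (1 / 2 ^ b) + if x = k then p x * (1 - 1 / 2 ^ b) else 0) := by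
      refine Finset.sum_congr rfl fun x _ => ?_
      split_ifs <;> ring
    rw [hs, Finset.sum_add_distrib, ← Finset.sum_mul, hp]
    simp only [Finset.sum_ite_eq', Finset.mem_univ, if_true, hashedMean]
    field_simp
    ring
  · intro x _ y _ hxy
    refine Set.disjoint_left.2 fun ω h1 h2 => hxy ?_
    exact h1.1.symm.trans h2.1
  · intro x _
    exact (hX (measurableSet_singleton x)).inter
      (hh (t := {g | g k = g x}) MeasurableSet.of_discrete)

/-- Since `γ` is finite, it is enough to compare the joint law with the product law on singletons,
where the product over pairs factors over clusters. -/
lemma iIndepFun_blocks {T n : ℕ} {γ : Type*} [Finite γ] [MeasurableSpace γ]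
    [MeasurableSingletonClass γ] {f : Fin T × Fin n → Ω → γ} (hf : ∀ i, Measurable (f i))
    (hind : iIndepFun f μ) : iIndepFun (fun t ω (j : Fin n) => f (t, j) ω) μ := by
  have hm : ∀ t, Measurable fun ω (j : Fin n) => f (t, j) ω := fun t =>
    measurable_pi_lambda _ fun j => hf (t, j)
  have hprob : ∀ t, IsProbabilityMeasure (μ.map fun ω (j : Fin n) => f (t, j) ω) := fun t =>
    Measure.isProbabilityMeasure_map (hm t).aemeasurable
  refine (iIndepFun_iff_map_fun_eq_pi_map fun t => (hm t).aemeasurable).2 ?_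
  refine Measure.ext_of_singleton fun w => ?_
  rw [Measure.pi_singleton, Measure.map_apply (measurable_pi_lambda _ hm) (measurableSet_singleton w)]
  have e : (fun ω t (j : Fin n) => f (t, j) ω) ⁻¹' {w}
      = ⋂ i ∈ (Finset.univ : Finset (Fin T × Fin n)), f i ⁻¹' {w i.1 i.2} := by
    ext ω
    simp [funext_iff]
  rw [e, hind.measure_inter_preimage_eq_mul _ fun i _ => measurableSet_singleton _,
    ← Finset.univ_product_univ, Finset.prod_product]
  refine Finset.prod_congr rfl fun t _ => ?_
  rw [Measure.map_apply (hm t) (measurableSet_singleton _)]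
  have e2 : (fun ω (j : Fin n) => f (t, j) ω) ⁻¹' {w t}
      = ⋂ j ∈ (Finset.univ : Finset (Fin n)), f (t, j) ⁻¹' {w t j} := by
    ext ω
    simp [funext_iff]
  rw [e2]
  exact ((hind.precomp (g := fun j : Fin n => (t, j)) fun i j hij => (Prod.mk.inj hij).2)
    |>.measure_inter_preimage_eq_mul _ fun i _ => measurableSet_singleton _).symm

variable {T n d b s : ℕ} {pstar : Fin d → ℝ} {p : Fin T → Fin d → ℝ} {X : Fin T → Fin n → Ω → Fin d}
  {h : Fin T → Fin n → Ω → Fin d → Fin (2 ^ b)}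

lemma hashedMean_nonneg {v : Fin d → ℝ} (hv : v ∈ stdSimplex ℝ (Fin d)) (k : Fin d) :
    0 ≤ hashedMean b v k := by
  have h1 := hv.1 k
  have h2 : (1 : ℝ) ≤ 2 ^ b := one_le_pow₀ one_le_two
  have : 0 ≤ (2 ^ b - 1) * v k := mul_nonneg (by linarith) h1
  unfold hashedMean; positivity

lemma apply_le_one_of_mem_stdSimplex {v : Fin d → ℝ} (hv : v ∈ stdSimplex ℝ (Fin d)) (k : Fin d) :
    v k ≤ 1 := by
  rw [← hv.2]
  exact Finset.single_le_sum (fun i _ => hv.1 i) (Finset.mem_univ k)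

lemma hashedMean_le_one {v : Fin d → ℝ} (hv : v ∈ stdSimplex ℝ (Fin d)) (k : Fin d) :
    hashedMean b v k ≤ 1 := by
  have h2 : (1 : ℝ) ≤ 2 ^ b := one_le_pow₀ one_le_two
  have := mul_le_mul_of_nonneg_left (apply_le_one_of_mem_stdSimplex hv k)
    (show (0 : ℝ) ≤ 2 ^ b - 1 by linarith)
  rw [hashedMean, div_le_one (by positivity)]
  linarith

/-- The numbers of messages of each cluster that agree with the hash of entry `k` are independent
binomial variables. -/
lemma Model.binomialCounts (hM : Model μ s pstar p X h) (k : Fin d) :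
    BinomialCounts μ n (fun t => hashedMean b (p t) k) fun t ω =>
      (Finset.univ.filter fun j => h t j ω k = h t j ω (X t j ω)).card := by
  have hf : ∀ i : Fin T × Fin n, Measurable fun ω => (X i.1 i.2 ω, h i.1 i.2 ω) := fun i =>
    (hM.measurable_X i.1 i.2).prodMk (hM.measurable_h i.1 i.2)
  have hcomp : ∀ t, (fun ω => (Finset.univ.filter fun j => h t j ω k = h t j ω (X t j ω)).card)
      = (fun w : Fin n → Fin d × (Fin d → Fin (2 ^ b)) =>
          (Finset.univ.filter fun j => (w j).2 k = (w j).2 (w j).1).card)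
        ∘ fun ω (j : Fin n) => (X t j ω, h t j ω) := fun t => rfl
  refine ⟨fun t => hashedMean_nonneg (hM.p_mem t) k, fun t => hashedMean_le_one (hM.p_mem t) k,
    fun t => ?_, fun t ω => ?_, fun t i => ?_, ?_⟩
  · rw [hcomp]
    exact Measurable.of_discrete.comp (measurable_pi_lambda _ fun j => hf (t, j))
  · exact (Finset.card_filter_le _ _).trans (by simp)
  · have hind := hM.indep.precomp (g := fun j : Fin n => (t, j)) fun i j hij => (Prod.mk.inj hij).2
    have := measureReal_count_eq (μ := μ) (fun j => hf (t, j)) hind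
      (A := fun _ => {w : Fin d × (Fin d → Fin (2 ^ b)) | w.2 k = w.2 w.1})
      (fun _ => MeasurableSet.of_discrete) Finset.univ (p := hashedMean b (p t) k) (fun j _ =>
        measureReal_collision (hM.p_mem t).2 (hM.measurable_X t j) (hM.measurable_h t j)
          (hM.indep_pair t j) (hM.law_X t j) (hM.law_h t j) k) i
    simp only [Finset.card_univ, Fintype.card_fin] at this
    convert this
    exact Iff.rfl
  · exact (iIndepFun_blocks hf hM.indep).comp (fun _ w =>
      (Finset.univ.filter fun j => (w j).2 k = (w j).2 (w j).1).card) fun _ => Measurable.of_discrete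

/-- The error of entry `k` of the estimate of cluster `t`. -/
noncomputable def entryError (α : ℝ) (p : Fin T → Fin d → ℝ) (X : Fin T → Fin n → Ω → Fin d)
    (h : Fin T → Fin n → Ω → Fin d → Fin (2 ^ b)) (t : Fin T) (k : Fin d) (ω : Ω) : ℝ :=
  estimator α (fun t' j => h t' j ω) (fun t' j => h t' j ω (X t' j ω)) t k - p t k

omit [IsProbabilityMeasure μ] in
lemma Model.abs_entryError_le (hM : Model μ s pstar p X h) (hb : 1 ≤ b) (α : ℝ) (t : Fin T)
    (k : Fin d) (ω : Ω) : |entryError α p X h t k ω| ≤ 1 ∧ |entryError α p X h t k ω|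
      ≤ 2 * |fineTuneEntry n α (fun t' =>
        ((Finset.univ.filter fun j => h t' j ω k = h t' j ω (X t' j ω)).card / n : ℝ)) t
          - hashedMean b (p t) k| :=
  abs_debias_sub_le hb ((hM.p_mem t).1 k) (apply_le_one_of_mem_stdSimplex (hM.p_mem t) k) _

omit [IsProbabilityMeasure μ] in
lemma Model.measurable_entryError (hM : Model μ s pstar p X h) (α : ℝ) (t : Fin T) (k : Fin d) :
    Measurable (entryError α p X h t k) := by
  have hf : Measurable fun ω (t' : Fin T) (j : Fin n) => (X t' j ω, h t' j ω) :=
    measurable_pi_lambda _ fun t' => measurable_pi_lambda _ fun j =>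
      (hM.measurable_X t' j).prodMk (hM.measurable_h t' j)
  have hG : Measurable fun w : Fin T → Fin n → Fin d × (Fin d → Fin (2 ^ b)) =>
      estimator α (fun t' j => (w t' j).2) (fun t' j => (w t' j).2 (w t' j).1) t k - p t k :=
    Measurable.of_discrete
  have e : entryError α p X h t k = (fun w : Fin T → Fin n → Fin d × (Fin d → Fin (2 ^ b)) =>
      estimator α (fun t' j => (w t' j).2) (fun t' j => (w t' j).2 (w t' j).1) t k - p t k)
      ∘ fun ω t' j => (X t' j ω, h t' j ω) := by
    funext ω
    simp only [entryError, Function.comp_apply]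
  rw [e]
  exact hG.comp hf

lemma Model.integrable_entryError_pow (hM : Model μ s pstar p X h) (hb : 1 ≤ b) (α : ℝ) (t : Fin T)
    (k : Fin d) (q : ℕ) : Integrable (fun ω => |entryError α p X h t k ω| ^ q) μ := by
  refine Integrable.of_bound (C := 1)
    (((hM.measurable_entryError α t k).norm.pow_const q).aestronglyMeasurable)
    (ae_of_all _ fun ω => ?_)
  rw [Real.norm_of_nonneg (by positivity)]
  exact pow_le_one₀ (abs_nonneg _) (hM.abs_entryError_le hb α t k ω).1

lemma Model.risk_eq (hM : Model μ s pstar p X h) (hb : 1 ≤ b) (α : ℝ) (t : Fin T) (q : ℕ) :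
    risk μ q α p X h t = ∑ k, ∫ ω, |entryError α p X h t k ω| ^ q ∂μ :=
  integral_finsetSum _ fun k _ => hM.integrable_entryError_pow hb α t k q

lemma Model.integral_entryError_sq_le (hM : Model μ s pstar p X h) (hb : 1 ≤ b) (hn : 0 < n) {α : ℝ}
    (hα : 0 ≤ α) (t : Fin T) (k : Fin d) :
    ∫ ω, |entryError α p X h t k ω| ^ 2 ∂μ ≤ 8 * (α + 1) * (hashedMean b (p t) k / n) := by
  simp_rw [sq_abs]
  exact integral_sq_le_local (hM.binomialCounts k) hn hα t fun ω =>
    (hM.abs_entryError_le hb α t k ω).2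

lemma Model.integral_entryError_sq_le_aligned (hM : Model μ s pstar p X h) (hb : 1 ≤ b) (hn : 2 ≤ n)
    {α : ℝ} (hα : 2 * (8 + √(8 * Real.log n)) ^ 2 ≤ α) {t : Fin T} {k : Fin d}
    (ht : p t k = pstar k) :
    ∫ ω, |entryError α p X h t k ω| ^ 2 ∂μ ≤ 16384 * α ^ 2 *
      (((misaligned pstar p k).card : ℝ) ^ 2 * hashedMean b pstar k / (T ^ 2 * n)
        + hashedMean b pstar k / (T * n) + 1 / n ^ 2) := by
  classical
  simp_rw [sq_abs]
  have hb2 : (2 : ℝ) ≤ 2 ^ b := by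
    calc (2 : ℝ) = 2 ^ 1 := by norm_num
      _ ≤ 2 ^ b := pow_le_pow_right₀ one_le_two hb
  -- For `b ≥ 1` hashing keeps distinct probabilities distinct, so the clusters deviating in mean
  -- are exactly the misaligned ones.
  have hiff : ∀ t', hashedMean b (p t') k = hashedMean b pstar k ↔ p t' k = pstar k := by
    intro t'
    have h1 : (2 : ℝ) ^ b - 1 ≠ 0 := by linarith
    rw [hashedMean, hashedMean, div_left_inj' (by positivity), add_left_inj, mul_right_inj' h1]
  have hmis : misaligned pstar p k
      = Finset.univ.filter fun t' => hashedMean b (p t') k ≠ hashedMean b pstar k := by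
    ext t'
    simp [misaligned, hiff]
  rw [hmis]
  convert integral_sq_le_aligned (hM.binomialCounts k) hn hα ((hiff t).2 ht)
    (fun ω => (hM.abs_entryError_le hb α t k ω).1) fun ω => (hM.abs_entryError_le hb α t k ω).2

end

end Shift

namespace Shift

/-! ### Summation over the entries -/

/-- Hölder's inequality: Cauchy–Schwarz for `q = 1`, an identity for `q = 2`. -/
lemma sum_rpow_mul_rpow_le {ι : Type*} (K : Finset ι) {a c : ι → ℝ} (ha : ∀ k, 0 ≤ a k)
    (hc : ∀ k, 0 ≤ c k) {q : ℕ} (hq : q = 1 ∨ q = 2) :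
    ∑ k ∈ K, a k ^ (1 - (q : ℝ) / 2) * c k ^ ((q : ℝ) / 2)
      ≤ (∑ k ∈ K, a k) ^ (1 - (q : ℝ) / 2) * (∑ k ∈ K, c k) ^ ((q : ℝ) / 2) := by
  rcases hq with rfl | rfl
  · have e : (1 : ℝ) - ((1 : ℕ) : ℝ) / 2 = 1 / 2 := by norm_num
    have e' : ((1 : ℕ) : ℝ) / 2 = 1 / 2 := by norm_num
    simp_rw [e, e', ← Real.sqrt_eq_rpow]
    exact Real.sum_sqrt_mul_sqrt_le K ha hc
  · norm_num

lemma rpow_half_le_mul {q : ℕ} (hq : q = 1 ∨ q = 2) {C x : ℝ} (hC : 1 ≤ C) (hx : 0 ≤ x) :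
    (C * x) ^ ((q : ℝ) / 2) ≤ C * x ^ ((q : ℝ) / 2) := by
  rw [Real.mul_rpow (by linarith) hx]
  refine mul_le_mul_of_nonneg_right ?_ (by positivity)
  calc C ^ ((q : ℝ) / 2) ≤ C ^ (1 : ℝ) := by
        refine Real.rpow_le_rpow_of_exponent_le hC ?_
        rcases hq with rfl | rfl <;> norm_num
    _ = C := Real.rpow_one C

lemma rpow_half_add_le {q : ℕ} (hq : q = 1 ∨ q = 2) {x y : ℝ} (hx : 0 ≤ x) (hy : 0 ≤ y) :
    (x + y) ^ ((q : ℝ) / 2) ≤ x ^ ((q : ℝ) / 2) + y ^ ((q : ℝ) / 2) := by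
  refine Real.rpow_add_le_add_rpow hx hy (by positivity) ?_
  rcases hq with rfl | rfl <;> norm_num

lemma one_div_sq_rpow_half {q : ℕ} (hq : q = 1 ∨ q = 2) {x : ℝ} (hx : 0 ≤ x) :
    (1 / x ^ 2) ^ ((q : ℝ) / 2) = 1 / x ^ q := by
  rcases hq with rfl | rfl
  · rw [← one_div_pow, ← Real.rpow_natCast, ← Real.rpow_mul (by positivity)]
    norm_num
  · norm_num

variable {T n d b s : ℕ} {pstar : Fin d → ℝ} {p : Fin T → Fin d → ℝ}

lemma hashedMean_le (v : Fin d → ℝ) {k : Fin d} (hv : 0 ≤ v k) :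
    hashedMean b v k ≤ v k + 1 / 2 ^ b := by
  have h2 : (0 : ℝ) < 2 ^ b := by positivity
  rw [hashedMean, div_le_iff₀ h2, add_mul, div_mul_cancel₀ _ h2.ne']
  nlinarith

lemma sum_hashedMean_le {v : Fin d → ℝ} (hv : v ∈ stdSimplex ℝ (Fin d)) (K : Finset (Fin d)) :
    ∑ k ∈ K, hashedMean b v k ≤ 1 + K.card / 2 ^ b := by
  calc ∑ k ∈ K, hashedMean b v k ≤ ∑ k ∈ K, (v k + 1 / 2 ^ b) :=
        Finset.sum_le_sum fun k _ => hashedMean_le v (hv.1 k)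
    _ = ∑ k ∈ K, v k + K.card / 2 ^ b := by
        rw [Finset.sum_add_distrib, Finset.sum_const, nsmul_eq_mul, mul_one_div]
    _ ≤ 1 + K.card / 2 ^ b := by
        have := Finset.sum_le_sum_of_subset_of_nonneg (Finset.subset_univ K)
          fun k _ _ => hv.1 k
        rw [hv.2] at this
        linarith

lemma card_misaligned_le (k : Fin d) : (misaligned pstar p k).card ≤ T := by
  simpa using Finset.card_le_univ (misaligned pstar p k)

lemma sum_card_misaligned_le
    (hs : ∀ t, ((Finset.univ : Finset (Fin d)).filter fun k => p t k ≠ pstar k).card ≤ s) :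
    ∑ k, (misaligned pstar p k).card ≤ s * T := by
  have : ∑ k, (misaligned pstar p k).card
      = ∑ t, ((Finset.univ : Finset (Fin d)).filter fun k => p t k ≠ pstar k).card := by
    simp_rw [misaligned, Finset.card_filter]
    exact Finset.sum_comm
  rw [this]
  refine (Finset.sum_le_card_nsmul _ _ s fun t _ => hs t).trans ?_
  simp [mul_comm]

/-- By double counting at most `5 s` entries are misaligned in a fifth of the clusters, and cluster
`t` itself deviates at no more than `s` entries. -/
lemma card_compl_aligned_le
    (hs : ∀ t, ((Finset.univ : Finset (Fin d)).filter fun k => p t k ≠ pstar k).card ≤ s)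
    (t : Fin T) : ((aligned (1 / 5) pstar p t)ᶜ.card : ℝ) ≤ 6 * s := by
  have hT : (0 : ℝ) < T := by exact_mod_cast t.pos
  set K := (Finset.univ : Finset (Fin d)).filter fun k => T ≤ 5 * (misaligned pstar p k).card
  have hK : (K.card : ℝ) ≤ 5 * s := by
    have h1 : K.card * T ≤ ∑ k, 5 * (misaligned pstar p k).card := by
      calc K.card * T = ∑ _k ∈ K, T := by rw [Finset.sum_const, smul_eq_mul]
        _ ≤ ∑ k ∈ K, 5 * (misaligned pstar p k).card :=
            Finset.sum_le_sum fun k hk => (Finset.mem_filter.1 hk).2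
        _ ≤ _ := Finset.sum_le_sum_of_subset (Finset.subset_univ K)
    rw [← Finset.mul_sum] at h1
    have h2 : K.card * T ≤ 5 * s * T := by
      have := sum_card_misaligned_le hs
      nlinarith
    exact_mod_cast Nat.le_of_mul_le_mul_right h2 t.pos
  have hsub : (aligned (1 / 5) pstar p t)ᶜ ⊆ K ∪ Finset.univ.filter fun k => p t k ≠ pstar k := by
    intro k hk
    rw [Finset.mem_union, Finset.mem_filter, Finset.mem_filter]
    by_cases hp : p t k = pstar k
    · left
      refine ⟨Finset.mem_univ k, ?_⟩
      by_contra hlt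
      refine Finset.mem_compl.1 hk (Finset.mem_filter.2 ⟨Finset.mem_univ k, ?_, hp⟩)
      have : 5 * ((misaligned pstar p k).card : ℝ) < T := by exact_mod_cast not_le.1 hlt
      linarith
    · exact Or.inr ⟨Finset.mem_univ k, hp⟩
  have h3 := (Finset.card_le_card hsub).trans (Finset.card_union_le _ _)
  have h4 : ((aligned (1 / 5) pstar p t)ᶜ.card : ℝ) ≤ K.card + s := by
    exact_mod_cast h3.trans (Nat.add_le_add_left (hs t) _)
  linarith

/-! ### Risk bounds in the data model. -/

variable {Ω : Type*} [MeasurableSpace Ω] {μ : Measure Ω} [IsProbabilityMeasure μ]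
  {X : Fin T → Fin n → Ω → Fin d} {h : Fin T → Fin n → Ω → Fin d → Fin (2 ^ b)}

/-- Jensen's inequality; for `q = 1` it is the nonnegativity of the variance of the absolute error.
-/
lemma Model.integral_entryError_pow_le (hM : Model μ s pstar p X h) (hb : 1 ≤ b) (α : ℝ)
    (t : Fin T) (k : Fin d) {q : ℕ} (hq : q = 1 ∨ q = 2) :
    ∫ ω, |entryError α p X h t k ω| ^ q ∂μ
      ≤ (∫ ω, |entryError α p X h t k ω| ^ 2 ∂μ) ^ ((q : ℝ) / 2) := by
  rcases hq with rfl | rfl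
  · have i1 : Integrable (fun ω => |entryError α p X h t k ω|) μ := by
      simpa using hM.integrable_entryError_pow hb α t k 1
    have i2 := hM.integrable_entryError_pow hb α t k 2
    simp only [pow_one, Nat.cast_one, ← Real.sqrt_eq_rpow]
    refine Real.le_sqrt_of_sq_le ?_
    set c := ∫ ω, |entryError α p X h t k ω| ∂μ
    have h0 : 0 ≤ ∫ ω, (|entryError α p X h t k ω| - c) ^ 2 ∂μ :=
      integral_nonneg fun ω => sq_nonneg _
    have e : ∀ ω, (|entryError α p X h t k ω| - c) ^ 2
        = |entryError α p X h t k ω| ^ 2 - (2 * c * |entryError α p X h t k ω| - c ^ 2) := by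
      intro ω; ring
    simp_rw [e] at h0
    have i3 : Integrable (fun ω => 2 * c * |entryError α p X h t k ω| - c ^ 2) μ :=
      (i1.const_mul _).sub (integrable_const _)
    rw [integral_sub i2 i3,
      integral_sub (i1.const_mul _) (integrable_const _), integral_const_mul, integral_const] at h0
    simp only [probReal_univ, smul_eq_mul, one_mul] at h0
    nlinarith
  · simp

/-- The bound on the risk before the contribution of the central distribution is summed up. -/
lemma Model.risk_le (hM : Model μ s pstar p X h) (hb : 1 ≤ b) (hn : 2 ≤ n) {α : ℝ}
    (hα : 2 * (8 + √(8 * Real.log n)) ^ 2 ≤ α) (t : Fin T) (η : ℝ) {q : ℕ} (hq : q = 1 ∨ q = 2) :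
    risk μ q α p X h t ≤ 16384 * α ^ 2 *
      (∑ k ∈ (aligned η pstar p t)ᶜ, (hashedMean b (p t) k / n) ^ ((q : ℝ) / 2)
        + ∑ k ∈ aligned η pstar p t, (((misaligned pstar p k).card : ℝ) ^ 2 * hashedMean b pstar k
          / (T ^ 2 * n)) ^ ((q : ℝ) / 2)
        + ∑ k, (hashedMean b pstar k / (T * n)) ^ ((q : ℝ) / 2) + d / n ^ q) := by
  have hr0 : 0 ≤ √(8 * Real.log n) := Real.sqrt_nonneg _
  have hα1 : 128 ≤ α := by nlinarith
  have hC : 1 ≤ 16384 * α ^ 2 := by nlinarith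
  have hβ : ∀ k, 0 ≤ hashedMean b (p t) k := hashedMean_nonneg (hM.p_mem t)
  have hβs : ∀ k, 0 ≤ hashedMean b pstar k := hashedMean_nonneg hM.pstar_mem
  have hθ : (0 : ℝ) ≤ (q : ℝ) / 2 := by positivity
  have h1 : ∀ k, ∫ ω, |entryError α p X h t k ω| ^ q ∂μ
      ≤ 16384 * α ^ 2 * (hashedMean b (p t) k / n) ^ ((q : ℝ) / 2) := by
    intro k
    have hx : 0 ≤ hashedMean b (p t) k / n := div_nonneg (hβ k) (by positivity)
    refine (hM.integral_entryError_pow_le hb α t k hq).trans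
      (le_trans (Real.rpow_le_rpow (integral_nonneg fun ω => by positivity) ?_ hθ)
        (rpow_half_le_mul hq hC hx))
    exact (hM.integral_entryError_sq_le hb (by omega) (by linarith) t k).trans
      (mul_le_mul_of_nonneg_right (by nlinarith) hx)
  have h2 : ∀ k ∈ aligned η pstar p t, ∫ ω, |entryError α p X h t k ω| ^ q ∂μ
      ≤ 16384 * α ^ 2 * ((((misaligned pstar p k).card : ℝ) ^ 2 * hashedMean b pstar k
          / (T ^ 2 * n)) ^ ((q : ℝ) / 2) + (hashedMean b pstar k / (T * n)) ^ ((q : ℝ) / 2)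
          + 1 / (n : ℝ) ^ q) := by
    intro k hk
    have x1 : 0 ≤ ((misaligned pstar p k).card : ℝ) ^ 2 * hashedMean b pstar k / (T ^ 2 * n) :=
      div_nonneg (mul_nonneg (by positivity) (hβs k)) (by positivity)
    have x2 : 0 ≤ hashedMean b pstar k / (T * n) := div_nonneg (hβs k) (by positivity)
    have x3 : (0 : ℝ) ≤ 1 / n ^ 2 := by positivity
    refine (hM.integral_entryError_pow_le hb α t k hq).trans
      (le_trans (Real.rpow_le_rpow (integral_nonneg fun ω => by positivity)
        (hM.integral_entryError_sq_le_aligned hb hn hα (Finset.mem_filter.1 hk).2.2) hθ)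
        ((rpow_half_le_mul hq hC (by positivity)).trans
          (mul_le_mul_of_nonneg_left ?_ (by positivity))))
    refine (rpow_half_add_le hq (by positivity) x3).trans ?_
    rw [one_div_sq_rpow_half hq (by positivity)]
    have := rpow_half_add_le hq x1 x2
    linarith
  rw [hM.risk_eq hb, ← Finset.sum_compl_add_sum (aligned η pstar p t)]
  refine (add_le_add (Finset.sum_le_sum fun k _ => h1 k) (Finset.sum_le_sum h2)).trans ?_
  rw [← Finset.mul_sum, ← Finset.mul_sum, ← mul_add]
  refine mul_le_mul_of_nonneg_left ?_ (by positivity)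
  rw [Finset.sum_add_distrib, Finset.sum_add_distrib]
  have h3 : ∑ k ∈ aligned η pstar p t, (hashedMean b pstar k / (T * n)) ^ ((q : ℝ) / 2)
      ≤ ∑ k, (hashedMean b pstar k / (T * n)) ^ ((q : ℝ) / 2) :=
    Finset.sum_le_sum_of_subset_of_nonneg (Finset.subset_univ _) fun k _ _ =>
      Real.rpow_nonneg (div_nonneg (hβs k) (by positivity)) _
  have h4 : ∑ k ∈ aligned η pstar p t, 1 / (n : ℝ) ^ q ≤ d / n ^ q := by
    rw [Finset.sum_const, nsmul_eq_mul, mul_one_div]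
    have : (aligned η pstar p t).card ≤ d := by
      simpa using Finset.card_le_univ (aligned η pstar p t)
    gcongr
  linarith

-- Hölder over at most `6 s` entries, whose hashed means sum to at most `1 + 6 s / 2 ^ b`, that is,
-- at most `7 max (2 ^ b) s / 2 ^ b`. The constant is `6 · 7`.
omit [IsProbabilityMeasure μ] in
lemma Model.sum_compl_aligned_le (hM : Model μ s pstar p X h) (t : Fin T) {q : ℕ}
    (hq : q = 1 ∨ q = 2) :
    ∑ k ∈ (aligned (1 / 5) pstar p t)ᶜ, (hashedMean b (p t) k / n) ^ ((q : ℝ) / 2)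
      ≤ 42 * ((s : ℝ) ^ (1 - (q : ℝ) / 2)
        * (max ((2 : ℝ) ^ b) s / ((2 : ℝ) ^ b * n)) ^ ((q : ℝ) / 2)) := by
  set K := (aligned (1 / 5) pstar p t)ᶜ
  have hcard : (K.card : ℝ) ≤ 6 * s := card_compl_aligned_le hM.sparse t
  have hβ : ∀ k, 0 ≤ hashedMean b (p t) k / n := fun k =>
    div_nonneg (hashedMean_nonneg (hM.p_mem t) k) (by positivity)
  have hθ : (0 : ℝ) ≤ (q : ℝ) / 2 := by positivity
  have hθ' : (0 : ℝ) ≤ 1 - (q : ℝ) / 2 := by rcases hq with rfl | rfl <;> norm_num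
  have hN : (0 : ℝ) < 2 ^ b := by positivity
  have hmax : 0 ≤ max ((2 : ℝ) ^ b) s / ((2 : ℝ) ^ b * n) := by positivity
  have h1 := sum_rpow_mul_rpow_le K (a := fun _ => (1 : ℝ)) (fun _ => zero_le_one) hβ hq
  simp only [Real.one_rpow, one_mul, Finset.sum_const, nsmul_eq_mul, mul_one] at h1
  refine h1.trans ?_
  have h2 : ∑ k ∈ K, hashedMean b (p t) k / n ≤ 7 * (max ((2 : ℝ) ^ b) s / ((2 : ℝ) ^ b * n)) := by
    rw [← Finset.sum_div, ← mul_div_assoc, ← div_div]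
    refine div_le_div_of_nonneg_right ((sum_hashedMean_le (hM.p_mem t) K).trans ?_) (by positivity)
    rw [le_div_iff₀ hN, add_mul, div_mul_cancel₀ _ hN.ne']
    have := le_max_left ((2 : ℝ) ^ b) s
    have := le_max_right ((2 : ℝ) ^ b) s
    linarith
  have h3 : (K.card : ℝ) ^ (1 - (q : ℝ) / 2) ≤ 6 * (s : ℝ) ^ (1 - (q : ℝ) / 2) := by
    refine (Real.rpow_le_rpow (by positivity) hcard hθ').trans ?_
    rw [Real.mul_rpow (by norm_num) (by positivity)]
    refine mul_le_mul_of_nonneg_right ?_ (by positivity)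
    calc (6 : ℝ) ^ (1 - (q : ℝ) / 2) ≤ 6 ^ (1 : ℝ) :=
          Real.rpow_le_rpow_of_exponent_le (by norm_num) (by linarith)
      _ = 6 := Real.rpow_one 6
  have h4 : (∑ k ∈ K, hashedMean b (p t) k / n) ^ ((q : ℝ) / 2)
      ≤ 7 * (max ((2 : ℝ) ^ b) s / ((2 : ℝ) ^ b * n)) ^ ((q : ℝ) / 2) :=
    (Real.rpow_le_rpow (Finset.sum_nonneg fun k _ => hβ k) h2 hθ).trans
      (rpow_half_le_mul hq (by norm_num) hmax)
  calc _ ≤ (6 * (s : ℝ) ^ (1 - (q : ℝ) / 2))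
        * (7 * (max ((2 : ℝ) ^ b) s / ((2 : ℝ) ^ b * n)) ^ ((q : ℝ) / 2)) :=
        mul_le_mul h3 h4 (Real.rpow_nonneg (Finset.sum_nonneg fun k _ => hβ k) _) (by positivity)
    _ = _ := by ring

-- With `u k` the fraction of misaligned clusters, the fractions lie in `[0, 1]` and sum to at most
-- `s`. Splitting `u² β = u · (u β)` and applying Hölder gives one factor bounded by the sparsity
-- and one by `∑ u β ≤ 1 + s / 2 ^ b`.
omit [IsProbabilityMeasure μ] in
lemma Model.sum_aligned_le (hM : Model μ s pstar p X h) (t : Fin T) (η : ℝ) {q : ℕ}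
    (hq : q = 1 ∨ q = 2) :
    ∑ k ∈ aligned η pstar p t, (((misaligned pstar p k).card : ℝ) ^ 2 * hashedMean b pstar k
          / (T ^ 2 * n)) ^ ((q : ℝ) / 2)
      ≤ 2 * ((s : ℝ) ^ (1 - (q : ℝ) / 2)
        * (max ((2 : ℝ) ^ b) s / ((2 : ℝ) ^ b * n)) ^ ((q : ℝ) / 2)) := by
  set K := aligned η pstar p t
  have hT : (0 : ℝ) < T := by exact_mod_cast t.pos
  have hβ : ∀ k, 0 ≤ hashedMean b pstar k := hashedMean_nonneg hM.pstar_mem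
  have hθ : (0 : ℝ) ≤ (q : ℝ) / 2 := by positivity
  have hθ' : (0 : ℝ) ≤ 1 - (q : ℝ) / 2 := by rcases hq with rfl | rfl <;> norm_num
  have hN : (0 : ℝ) < 2 ^ b := by positivity
  have hmax : 0 ≤ max ((2 : ℝ) ^ b) s / ((2 : ℝ) ^ b * n) := by positivity
  set u : Fin d → ℝ := fun k => (misaligned pstar p k).card / T with hu
  have hu0 : ∀ k, 0 ≤ u k := fun k => by positivity
  have hu1 : ∀ k, u k ≤ 1 := fun k => by
    rw [hu]; simp only; rw [div_le_one hT]; exact_mod_cast card_misaligned_le k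
  have hsum : ∑ k ∈ K, u k ≤ s := by
    refine (Finset.sum_le_sum_of_subset_of_nonneg (Finset.subset_univ K) fun k _ _ => hu0 k).trans ?_
    rw [hu, ← Finset.sum_div, div_le_iff₀ hT]
    exact_mod_cast sum_card_misaligned_le hM.sparse
  have huβ : ∀ k, 0 ≤ u k * hashedMean b pstar k / n := fun k =>
    div_nonneg (mul_nonneg (hu0 k) (hβ k)) (by positivity)
  have hterm : ∀ k, (((misaligned pstar p k).card : ℝ) ^ 2 * hashedMean b pstar k
      / (T ^ 2 * n)) ^ ((q : ℝ) / 2)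
      ≤ u k ^ (1 - (q : ℝ) / 2) * (u k * hashedMean b pstar k / n) ^ ((q : ℝ) / 2) := by
    intro k
    have e : ((misaligned pstar p k).card : ℝ) ^ 2 * hashedMean b pstar k / (T ^ 2 * n)
        = u k * (u k * hashedMean b pstar k / n) := by rw [hu]; field_simp
    rw [e]
    rcases hq with rfl | rfl
    · have e : (1 : ℝ) - ((1 : ℕ) : ℝ) / 2 = ((1 : ℕ) : ℝ) / 2 := by norm_num
      rw [e, Real.mul_rpow (hu0 k) (huβ k)]
    · norm_num
      exact mul_le_of_le_one_left (huβ k) (hu1 k)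
  refine (Finset.sum_le_sum fun k _ => hterm k).trans
    ((sum_rpow_mul_rpow_le K hu0 huβ hq).trans ?_)
  have h2 : ∑ k ∈ K, u k * hashedMean b pstar k / n
      ≤ 2 * (max ((2 : ℝ) ^ b) s / ((2 : ℝ) ^ b * n)) := by
    rw [← Finset.sum_div, ← mul_div_assoc, ← div_div]
    refine div_le_div_of_nonneg_right ?_ (by positivity)
    have h3 : ∑ k ∈ K, u k * hashedMean b pstar k ≤ ∑ k ∈ K, (pstar k + u k / 2 ^ b) := by
      refine Finset.sum_le_sum fun k _ => ?_
      have hp := hM.pstar_mem.1 k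
      have := mul_le_mul_of_nonneg_left (hashedMean_le (b := b) pstar hp) (hu0 k)
      have h5 : u k * pstar k ≤ pstar k := mul_le_of_le_one_left hp (hu1 k)
      rw [mul_add, mul_one_div] at this
      linarith
    have h4 : ∑ k ∈ K, pstar k ≤ 1 := by
      rw [← hM.pstar_mem.2]
      exact Finset.sum_le_sum_of_subset_of_nonneg (Finset.subset_univ K)
        fun k _ _ => hM.pstar_mem.1 k
    rw [Finset.sum_add_distrib, ← Finset.sum_div] at h3
    rw [le_div_iff₀ hN]
    have h5 := mul_le_mul_of_nonneg_right h3 hN.le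
    rw [add_mul, div_mul_cancel₀ _ hN.ne'] at h5
    have := le_max_left ((2 : ℝ) ^ b) s
    have := le_max_right ((2 : ℝ) ^ b) s
    nlinarith
  have h4 : (∑ k ∈ K, u k * hashedMean b pstar k / n) ^ ((q : ℝ) / 2)
      ≤ 2 * (max ((2 : ℝ) ^ b) s / ((2 : ℝ) ^ b * n)) ^ ((q : ℝ) / 2) :=
    (Real.rpow_le_rpow (Finset.sum_nonneg fun k _ => huβ k) h2 hθ).trans
      (rpow_half_le_mul hq (by norm_num) hmax)
  calc _ ≤ (s : ℝ) ^ (1 - (q : ℝ) / 2)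
        * (2 * (max ((2 : ℝ) ^ b) s / ((2 : ℝ) ^ b * n)) ^ ((q : ℝ) / 2)) :=
        mul_le_mul (Real.rpow_le_rpow (Finset.sum_nonneg fun k _ => hu0 k) hsum hθ') h4
          (Real.rpow_nonneg (Finset.sum_nonneg fun k _ => huβ k) _) (by positivity)
    _ = _ := by ring

/-- The hashed means sum to at most `1 + d / 2 ^ b`, and `2 ^ b ≤ d` absorbs the 1; Hölder over all
`d` entries does the rest. -/
lemma sum_central_le {v : Fin d → ℝ} (hv : v ∈ stdSimplex ℝ (Fin d)) (hbd : 2 ^ b ≤ d)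
    {q : ℕ} (hq : q = 1 ∨ q = 2) :
    ∑ k, (hashedMean b v k / (T * n)) ^ ((q : ℝ) / 2)
      ≤ 2 * (d / ((2 : ℝ) ^ b * T * n) ^ ((q : ℝ) / 2)) := by
  have hN : (0 : ℝ) < 2 ^ b := by positivity
  have hd : (0 : ℝ) < d := by
    have : 0 < d := lt_of_lt_of_le (by positivity) hbd
    exact_mod_cast this
  have hbd' : (2 : ℝ) ^ b ≤ d := by exact_mod_cast hbd
  have hβ : ∀ k, 0 ≤ hashedMean b v k / (T * n) := fun k =>
    div_nonneg (hashedMean_nonneg hv k) (by positivity)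
  have hy : 0 ≤ (2 : ℝ) ^ b * T * n := by positivity
  have h1 := sum_rpow_mul_rpow_le Finset.univ (a := fun _ => (1 : ℝ)) (fun _ => zero_le_one) hβ hq
  simp only [Real.one_rpow, one_mul, Finset.sum_const, nsmul_eq_mul, mul_one, Finset.card_univ,
    Fintype.card_fin] at h1
  refine h1.trans ?_
  have h2 : ∑ k, hashedMean b v k / (T * n) ≤ 2 * (d / ((2 : ℝ) ^ b * T * n)) := by
    have e : 2 * (d / ((2 : ℝ) ^ b * T * n)) = 2 * d / 2 ^ b / (T * n) := by
      rw [div_div, ← mul_div_assoc, mul_assoc]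
    rw [← Finset.sum_div, e]
    refine div_le_div_of_nonneg_right ((sum_hashedMean_le hv _).trans ?_) (by positivity)
    rw [Finset.card_univ, Fintype.card_fin, two_mul, add_div, add_le_add_iff_right,
      le_div_iff₀ hN, one_mul]
    exact hbd'
  have h3 : (∑ k, hashedMean b v k / (T * n)) ^ ((q : ℝ) / 2)
      ≤ 2 * (d / ((2 : ℝ) ^ b * T * n)) ^ ((q : ℝ) / 2) :=
    (Real.rpow_le_rpow (Finset.sum_nonneg fun k _ => hβ k) h2 (by positivity)).trans
      (rpow_half_le_mul hq (by norm_num) (by positivity))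
  calc _ ≤ (d : ℝ) ^ (1 - (q : ℝ) / 2) * (2 * (d / ((2 : ℝ) ^ b * T * n)) ^ ((q : ℝ) / 2)) :=
        mul_le_mul_of_nonneg_left h3 (by positivity)
    _ = 2 * ((d : ℝ) ^ (1 - (q : ℝ) / 2) * d ^ ((q : ℝ) / 2)
          / ((2 : ℝ) ^ b * T * n) ^ ((q : ℝ) / 2)) := by
        rw [Real.div_rpow hd.le hy]; ring
    _ = _ := by
        rw [← Real.rpow_add hd, sub_add_cancel, Real.rpow_one]

/-- The squared error without the assumption `2 ^ b ≤ d`. -/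
lemma Model.risk_two_le (hM : Model μ s pstar p X h) (hb : 1 ≤ b) (hn : 2 ≤ n) {α : ℝ}
    (hα : 2 * (8 + √(8 * Real.log n)) ^ 2 ≤ α) (t : Fin T) :
    risk μ 2 α p X h t ≤ 16384 * α ^ 2 * (45 * (max ((2 : ℝ) ^ b) s / ((2 : ℝ) ^ b * n)
      + d / ((2 : ℝ) ^ b * T * n) + d / (n : ℝ) ^ 2)) := by
  have hT : (1 : ℝ) ≤ T := by exact_mod_cast t.pos
  have hn0 : (0 : ℝ) < n := by exact_mod_cast (by omega : 0 < n)
  have hN : (0 : ℝ) < 2 ^ b := by positivity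
  refine (hM.risk_le hb hn hα t (1 / 5) (Or.inr rfl)).trans
    (mul_le_mul_of_nonneg_left ?_ (by positivity))
  have h1 := hM.sum_compl_aligned_le t (Or.inr rfl)
  have h2 := hM.sum_aligned_le t (1 / 5) (Or.inr rfl)
  have e0 : ((2 : ℕ) : ℝ) / 2 = 1 := by norm_num
  simp only [e0, sub_self, Real.rpow_zero, Real.rpow_one, one_mul] at h1 h2 ⊢
  have h3 : ∑ k, hashedMean b pstar k / (T * n)
      ≤ max ((2 : ℝ) ^ b) s / ((2 : ℝ) ^ b * n) + d / ((2 : ℝ) ^ b * T * n) := by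
    rw [← Finset.sum_div]
    have h4 := sum_hashedMean_le (b := b) hM.pstar_mem Finset.univ
    rw [Finset.card_univ, Fintype.card_fin] at h4
    have h5 : (∑ k, hashedMean b pstar k) / (T * n) ≤ (1 + d / 2 ^ b) / (T * n) :=
      div_le_div_of_nonneg_right h4 (by positivity)
    have h6 : (1 + (d : ℝ) / 2 ^ b) / (T * n) = 1 / (T * n) + d / ((2 : ℝ) ^ b * T * n) := by
      field_simp
    have h7 : 1 / (T * n : ℝ) ≤ 1 / n :=
      one_div_le_one_div_of_le hn0 (le_mul_of_one_le_left hn0.le hT)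
    -- Without `2 ^ b ≤ d` the stray `1 / (T n)` goes into the sparsity term, which for `q = 2` is
    -- at least `1 / n`.
    have h8 : 1 / (n : ℝ) ≤ max ((2 : ℝ) ^ b) s / ((2 : ℝ) ^ b * n) := by
      rw [div_le_div_iff₀ hn0 (by positivity), one_mul]
      exact mul_le_mul_of_nonneg_right (le_max_left _ _) hn0.le
    linarith
  have q1 : 0 ≤ (d : ℝ) / ((2 : ℝ) ^ b * T * n) := by positivity
  have q2 : 0 ≤ (d : ℝ) / (n : ℝ) ^ 2 := by positivity
  linarith

end Shift

theorem theorem1 :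
    -- squared Euclidean error, for `n = Ω(2 ^ b ln n)` and `α = Θ(ln n)`
    (∃ c : ℝ, 0 < c ∧ ∃ m : ℕ, ∀ κ : ℝ, 0 < κ → ∀ A : ℝ, 0 < A → ∃ C : ℝ, 0 < C ∧
      ∀ (Ω : Type*) [MeasurableSpace Ω] (μ : Measure Ω) [IsProbabilityMeasure μ]
        (T n d b s : ℕ) (pstar : Fin d → ℝ) (p : Fin T → Fin d → ℝ)
        (X : Fin T → Fin n → Ω → Fin d) (h : Fin T → Fin n → Ω → Fin d → Fin (2 ^ b)) (α : ℝ),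
        2 ≤ n → 1 ≤ b → Shift.Model μ s pstar p X h →
        κ * (2 : ℝ) ^ b * Real.log n ≤ n → c * Real.log n ≤ α → α ≤ A * Real.log n →
        ∀ t : Fin T,
          Shift.risk μ 2 α p X h t ≤ C * Real.log n ^ m *
            (max ((2 : ℝ) ^ b) s / ((2 : ℝ) ^ b * n) + (d : ℝ) / ((2 : ℝ) ^ b * T * n)
              + (d : ℝ) / (n : ℝ) ^ 2)) ∧
    -- detailed version, for the `q`-th power of the `ℓ_q` error, `q = 1, 2`
    (∃ m : ℕ, ∀ A : ℝ, 0 < A → ∃ C : ℝ, 0 < C ∧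
      ∀ (Ω : Type*) [MeasurableSpace Ω] (μ : Measure Ω) [IsProbabilityMeasure μ]
        (T n d b s : ℕ) (pstar : Fin d → ℝ) (p : Fin T → Fin d → ℝ)
        (X : Fin T → Fin n → Ω → Fin d) (h : Fin T → Fin n → Ω → Fin d → Fin (2 ^ b)) (α : ℝ),
        1 ≤ n → 1 ≤ b → 2 ^ b ≤ d → Shift.Model μ s pstar p X h →
        (2 : ℝ) ^ (b + 6) * Real.log n ≤ n →
        2 * (8 + Real.sqrt (8 * Real.log n)) ^ 2 ≤ α → α ≤ A * Real.log n →
        ∀ q : ℕ, q = 1 ∨ q = 2 → ∀ t : Fin T,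
          (∀ η : ℝ, 0 < η → η ≤ 1 / 5 →
            Shift.risk μ q α p X h t ≤ C * Real.log n ^ m *
              (∑ k ∈ (Shift.aligned η pstar p t)ᶜ,
                  (Shift.hashedMean b (p t) k / n) ^ ((q : ℝ) / 2)
                + ∑ k ∈ Shift.aligned η pstar p t,
                  (((Shift.misaligned pstar p k).card : ℝ) ^ 2 * Shift.hashedMean b pstar k
                    / ((T : ℝ) ^ 2 * n)) ^ ((q : ℝ) / 2)
                + Shift.remainder q n d b T)) ∧
          Shift.risk μ q α p X h t ≤ C * Real.log n ^ m *
            ((s : ℝ) ^ (1 - (q : ℝ) / 2)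
                * (max ((2 : ℝ) ^ b) s / ((2 : ℝ) ^ b * n)) ^ ((q : ℝ) / 2)
              + Shift.remainder q n d b T)) := by
  -- The power 2 of the logarithm comes from `α² ≤ A² (log n)²`. The value 500 makes `α` exceed `2
  -- (8 + √(8 log n))² ≤ 256 + 32 log n`, as `log n ≥ 0.693`.
  refine ⟨⟨500, by norm_num, 2, fun κ _ A hA => ⟨16384 * 45 * A ^ 2, by positivity, ?_⟩⟩,
    ⟨2, fun A hA => ⟨16384 * 44 * A ^ 2, by positivity, ?_⟩⟩⟩
  · intro Ω _ μ _ T n d b s pstar p X h α hn hb hM _ hc hα t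
    have hn' : (2 : ℝ) ≤ n := by exact_mod_cast hn
    have hlog : 0.693 ≤ Real.log n := by
      have := Real.log_two_gt_d9
      have := Real.log_le_log (by norm_num) hn'
      linarith
    have hr : √(8 * Real.log n) ^ 2 = 8 * Real.log n := Real.sq_sqrt (by linarith)
    have hα' : 2 * (8 + √(8 * Real.log n)) ^ 2 ≤ α := by
      nlinarith [sq_nonneg (8 - √(8 * Real.log n))]
    refine (hM.risk_two_le hb hn hα' t).trans ?_
    rw [← mul_assoc]
    refine mul_le_mul_of_nonneg_right ?_ (by positivity)
    have : α ^ 2 ≤ (A * Real.log n) ^ 2 := pow_le_pow_left₀ (by linarith) hα 2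
    rw [mul_pow] at this
    linarith
  · intro Ω _ μ _ T n d b s pstar p X h α hn1 hb hbd hM _ hα hαA q hq t
    have hα1 : 128 ≤ α := by
      have := Real.sqrt_nonneg (8 * Real.log n)
      nlinarith
    have hn : 2 ≤ n := by
      -- For `n = 1` the upper bound on `α` is 0, contradicting `α ≥ 128`.
      by_contra hlt
      have : n = 1 := by omega
      subst this
      simp at hαA
      linarith
    have hα2 : α ^ 2 ≤ A ^ 2 * Real.log n ^ 2 := by
      rw [← mul_pow]
      exact pow_le_pow_left₀ (by linarith) hαA 2
    have hcentral := Shift.sum_central_le (T := T) (n := n) hM.pstar_mem hbd hq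
    have hβ : ∀ k, 0 ≤ Shift.hashedMean b (p t) k := Shift.hashedMean_nonneg (hM.p_mem t)
    have hβs : ∀ k, 0 ≤ Shift.hashedMean b pstar k := Shift.hashedMean_nonneg hM.pstar_mem
    have x3 : 0 ≤ (d : ℝ) / ((2 : ℝ) ^ b * T * n) ^ ((q : ℝ) / 2) := by positivity
    have x4 : 0 ≤ (d : ℝ) / (n : ℝ) ^ q := by positivity
    have hscale : ∀ {W : ℝ}, 0 ≤ W →
        16384 * α ^ 2 * (44 * W) ≤ 16384 * 44 * A ^ 2 * Real.log n ^ 2 * W := by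
      intro W hW
      have := mul_le_mul_of_nonneg_right hα2 hW
      linarith
    constructor
    · intro η _ _
      have x1 : 0 ≤ ∑ k ∈ (Shift.aligned η pstar p t)ᶜ,
          (Shift.hashedMean b (p t) k / n) ^ ((q : ℝ) / 2) :=
        Finset.sum_nonneg fun k _ => Real.rpow_nonneg (div_nonneg (hβ k) (by positivity)) _
      have x2 : 0 ≤ ∑ k ∈ Shift.aligned η pstar p t, (((Shift.misaligned pstar p k).card : ℝ) ^ 2
          * Shift.hashedMean b pstar k / ((T : ℝ) ^ 2 * n)) ^ ((q : ℝ) / 2) :=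
        Finset.sum_nonneg fun k _ => Real.rpow_nonneg
          (div_nonneg (mul_nonneg (by positivity) (hβs k)) (by positivity)) _
      refine (hM.risk_le hb hn hα t η hq).trans (le_trans ?_ (hscale ?_))
      · refine mul_le_mul_of_nonneg_left ?_ (by positivity)
        unfold Shift.remainder
        linarith
      · unfold Shift.remainder
        linarith
    · have x1 : 0 ≤ (s : ℝ) ^ (1 - (q : ℝ) / 2)
          * (max ((2 : ℝ) ^ b) s / ((2 : ℝ) ^ b * n)) ^ ((q : ℝ) / 2) := by positivity
      have h1 := hM.sum_compl_aligned_le t hq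
      have h2 := hM.sum_aligned_le t (1 / 5) hq
      refine (hM.risk_le hb hn hα t (1 / 5) hq).trans (le_trans ?_ (hscale ?_))
      · refine mul_le_mul_of_nonneg_left ?_ (by positivity)
        unfold Shift.remainder
        linarith
      · unfold Shift.remainder
        linarith
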